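/- Let $n,k$ be positive integers and order $\{0,1,\dots,k\}^n$ componentwise. Write $|A|=\sum_{i=1}^n A_i$ for $A\in\{0,1,\dots,k\}^n$. A family $\mathcal F\subseteq\{0,1,\dots,k\}^n$ is \emph{centered} if $\bigl||A|-\tfrac{nk}{2}\bigr|\le\bigl||B|-\tfrac{nk}{2}\bigr|$ for all $A\in\mathcal F$ and all $B\in\{0,1,\dots,k\}^n\setminus\mathcal F$. Let $\mathrm{comp}(\mathcal F)$ be the number of (unordered) pairs of distinct comparable elements of $\mathcal F$. For an integer $M\ge 0$, a family $\mathcal F$ of size $M$ is \emph{$M$-optimal} if $\mathrm{comp}(\mathcal F)\le\mathrm{comp}(\mathcal F')$ for every family $\mathcal F'\subseteq\{0,1,\dots,k\}^n$ of size $M$. The poset $\{0,1,\dots,k\}^n$ has the \emph{centeredness property} if for every integer $0\le M\le (k+1)^n$ there is an $M$-optimal centered family. The $t$-th layer is $\{A\in\{0,1,\dots,k\}^n:|A|=t\}$, and $\Sigma_r(n,k)$ denotes the total size of the $r$ middle layers; in particular, for $k=2$, $\Sigma_3(n,2)$ is the number of $A\in\{0,1,2\}^n$ with $n-1\le|A|\le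 n+1$, and $\Sigma_6(n,2)$ is the number of $A\in\{0,1,2\}^n$ with $n-3\le|A|\le n+2$ (equivalently, by symmetry, with $n-2\le |A|\le n+3$). \textbf{Theorem.} (a) For every $\varepsilon>0$ there is an $n_0=n_0(\varepsilon)$ such that for all $n\ge n_0$ and all integers $0\le M\le(1-\varepsilon)\,\Sigma_3(n,2)$ there exists an $M$-optimal centered family in $\{0,1,2\}^n$. (b) There is an $n_0$ such that for all $n\ge n_0$, with $M=\Sigma_6(n,2)-\binom n3-1$ (which is then a non-negative integer), no centered family in $\{0,1,2\}^n$ is $M$-optimal. In particular, the conjecture of Noel--Scott--Sudakov and Balogh--Wagner, that for every $k$ the poset $\{0,1,\dots,k\}^n$ has the centeredness property for all sufficiently large $n$, fails for $k=2$: there is no $n_0$ such that $\{0,1,2\}^n$ has the centeredness property for all $n\ge n_0$. -/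

import Mathlib

namespace CenteredFamilies

/-- The poset `{0, 1, …, k}^n`, with the componentwise order (the order of a function type). -/
abbrev Grid (n k : ℕ) : Type := Fin n → Fin (k + 1)

/-- The rank of a vector: the sum of its coordinates. -/
def rank {n k : ℕ} (A : Grid n k) : ℕ := ∑ i, (A i : ℕ)

/-- The `r`-th layer of `{0, 1, …, k}^n`: the vectors whose coordinates sum to `r`. -/
def layer (n k r : ℕ) : Finset (Grid n k) := Finset.univ.filter (fun A => rank A = r)

/-- The ranks `t` of the `r` middle layers of `{0, 1, …, k}^n`: those with
`nk/2 - r/2 ≤ t < nk/2 + r/2`. For `r ≤ nk + 1` these are `r` consecutive ranks in `{0, …, nk}`,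
centred at `nk/2` as well as parity permits; when there are two such choices the lower
one is taken (the other one is its image under `t ↦ nk - t`, and has the same layer sizes),
so `r = 1` gives the layer of rank `⌊nk/2⌋`. -/
def middleRanks (n k r : ℕ) : Finset ℕ :=
  (Finset.range (n * k + 1)).filter (fun t => n * k ≤ 2 * t + r ∧ 2 * t < n * k + r)

/-- The total size `Σ_r(n, k)` of the `r` middle layers of `{0, 1, …, k}^n`. -/
def middleSize (r n k : ℕ) : ℕ := ∑ t ∈ middleRanks n k r, (layer n k t).card

/-- A family is centered if each of its members is at least as close to the middle rank `nk/2`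
as each vector outside of the family. -/
def IsCentered {n k : ℕ} (F : Finset (Grid n k)) : Prop :=
  ∀ A B : Grid n k, A ∈ F → B ∉ F →
    |(rank A : ℝ) - (n : ℝ) * (k : ℝ) / 2| ≤ |(rank B : ℝ) - (n : ℝ) * (k : ℝ) / 2|

open Classical in
/-- The number of comparable pairs of distinct members of a family; each unordered pair
`{A, B}` is counted once, as the ordered pair with `A < B`. -/
noncomputable def comp {n k : ℕ} (F : Finset (Grid n k)) : ℕ :=
  ((F ×ˢ F).filter (fun p => p.1 < p.2)).card

/-- `F` has size `M`, and the fewest comparable pairs among all families of size `M`. -/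
def IsOptimal {n k : ℕ} (M : ℕ) (F : Finset (Grid n k)) : Prop :=
  F.card = M ∧ ∀ F' : Finset (Grid n k), F'.card = M → comp F ≤ comp F'

/-- The centeredness property of `{0, 1, …, k}^n`: for every `M` up to the size of the poset
there is an `M`-optimal centered family. -/
def HasCenterednessProperty (n k : ℕ) : Prop :=
  ∀ M : ℕ, M ≤ Fintype.card (Grid n k) →
    ∃ F : Finset (Grid n k), IsOptimal M F ∧ IsCentered F

end CenteredFamilies

namespace CenteredFamilies

/-! Part (a). Among the optimal families of size M, take one of least total distance from rank n (a
tight family). From rank n upwards, x has at least as many elements j levels below it as any y ≤ x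
has j levels above it. So pushing members down along a suitable matching (`exists_matching`,
`exists_push`) creates no additional comparable pairs. A tight family is therefore closed downwards
as far as rank n and, by reversal, closed upwards from below as far as rank n; once it is large
enough it contains the whole middle layer.

Members outside ranks n - 1, n, n + 1 are then exchanged for as many missing elements of ranks n ± 1
having the smallest loads. A fractional flow from rank n + 2 to rank n - 1, with outflow one and
inflow at most one, shows that the exchange destroys at least as many pairs as it creates
(`UpperClosed.sum_sub_saving_le`), while it shrinks the spread; so a tight family has no such
members (`IsTight.rank_mem`). This needs enough missing elements of moderate load. High load means
few coordinates equal to 2, and such elements form an exponentially small part of their layer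
(`card_fewTwos_le_pow`); the factor 1 - ε leaves room for them.

Part (b). A centered family of the critical size consists of the five middle layers, a part X of
layer n - 3 and a part Y of layer n + 3. Sort the outer elements into classes: a is the number of 2s
in X and of 0s in Y. An element of class a has `weight n a` comparable elements in the middle
layers, and this decreases convexly in a. Without pairs between X and Y, filling both halves of the
cheap classes would be best, but such pairs cost on the order of n^6 per superfluous element,
against weights of order n^5. Hence no centered family beats layer n + 3 without its C(n,3) elements
of class 0 and, in effect, one element of class 1 (`comp_add_le`).

But starting from the five layers and the classes a ≥ 1 of layer n + 3, one can instead delete an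
element of rank n - 2 without 2s. Its degree exceeds that of class 1 (`weight_one_add_lt`), so the
resulting non-centered family has fewer comparable pairs. -/

open Finset Classical Polynomial

/-! ### Coordinates, rank and reversal -/

/-- The number of coordinates equal to `0`. -/
def zeros {n : ℕ} (x : Grid n 2) : ℕ := #{i | x i = 0}
/-- The number of coordinates equal to `1`. -/
def ones {n : ℕ} (x : Grid n 2) : ℕ := #{i | x i = 1}
/-- The number of coordinates equal to `2`. -/
def twos {n : ℕ} (x : Grid n 2) : ℕ := #{i | x i = 2}

/-- The order-reversing involution of the grid. -/
def reversal {n : ℕ} (x : Grid n 2) : Grid n 2 := fun i => Fin.rev (x i)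

variable {n : ℕ}

lemma fin_three_cases (v : Fin (2 + 1)) : v = 0 ∨ v = 1 ∨ v = 2 := by
  revert v; decide

lemma zeros_add_ones_add_twos (x : Grid n 2) : zeros x + ones x + twos x = n := by
  have h : ∑ i : Fin n, ((if x i = 0 then 1 else 0) + (if x i = 1 then 1 else 0)
      + (if x i = 2 then 1 else 0)) = ∑ _i : Fin n, 1 := by
    refine sum_congr rfl fun i _ => ?_
    rcases fin_three_cases (x i) with h | h | h <;> simp [h]
  simpa [sum_add_distrib, zeros, ones, twos] using h

lemma rank_eq_ones_add (x : Grid n 2) : rank x = ones x + 2 * twos x := by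
  have h : ∑ i : Fin n, (x i : ℕ) = ∑ i : Fin n, ((if x i = 1 then 1 else 0)
      + 2 * (if x i = 2 then 1 else 0)) := by
    refine sum_congr rfl fun i _ => ?_
    rcases fin_three_cases (x i) with h | h | h <;> simp [h]
  rw [rank, h, sum_add_distrib, ← mul_sum]
  simp [ones, twos]

lemma rank_add_zeros (x : Grid n 2) : rank x + zeros x = n + twos x := by
  have := zeros_add_ones_add_twos x
  have := rank_eq_ones_add x
  omega

lemma rank_le (x : Grid n 2) : rank x ≤ 2 * n := by
  have := zeros_add_ones_add_twos x
  have := rank_eq_ones_add x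
  omega

@[simp] lemma reversal_reversal (x : Grid n 2) : reversal (reversal x) = x := by
  ext i; simp [reversal]

lemma reversal_injective : Function.Injective (reversal (n := n)) :=
  Function.LeftInverse.injective reversal_reversal

@[simp] lemma reversal_le_reversal {x y : Grid n 2} : reversal x ≤ reversal y ↔ y ≤ x := by
  simp [reversal, Pi.le_def]

@[simp] lemma reversal_lt_reversal {x y : Grid n 2} : reversal x < reversal y ↔ y < x := by
  simp [lt_iff_le_not_ge]

@[simp] lemma zeros_reversal (x : Grid n 2) : zeros (reversal x) = twos x := by
  refine congrArg card (filter_congr fun i _ => ?_)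
  rcases fin_three_cases (x i) with h | h | h <;> simp only [reversal, h] <;> decide

@[simp] lemma twos_reversal (x : Grid n 2) : twos (reversal x) = zeros x := by
  simpa using (zeros_reversal (reversal x)).symm

@[simp] lemma ones_reversal (x : Grid n 2) : ones (reversal x) = ones x := by
  have h1 := zeros_add_ones_add_twos x
  have h2 := zeros_add_ones_add_twos (reversal x)
  simp at h2
  omega

lemma rank_reversal (x : Grid n 2) : rank (reversal x) + rank x = 2 * n := by
  have h1 := zeros_add_ones_add_twos x
  have h3 := rank_eq_ones_add x
  have h4 := rank_eq_ones_add (reversal x)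
  simp at h4
  omega

lemma rank_mono {x y : Grid n 2} (h : x ≤ y) : rank x ≤ rank y :=
  sum_le_sum fun i _ => Fin.le_def.1 (h i)

lemma rank_strictMono {x y : Grid n 2} (h : x < y) : rank x < rank y := by
  obtain ⟨hle, i, hi⟩ := Pi.lt_def.1 h
  exact sum_lt_sum (fun i _ => Fin.le_def.1 (hle i)) ⟨i, mem_univ _, Fin.lt_def.1 hi⟩

lemma eq_of_le_of_rank_eq {x y : Grid n 2} (h : x ≤ y) (hr : rank x = rank y) : x = y := by
  by_contra hne
  have := rank_strictMono (lt_of_le_of_ne h hne)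
  omega

lemma twos_mono {x y : Grid n 2} (h : x ≤ y) : twos x ≤ twos y := by
  refine card_le_card fun i hi => ?_
  simp only [mem_filter, mem_univ, true_and] at hi ⊢
  have := h i
  rw [hi] at this
  exact le_antisymm (Fin.le_last _) this

lemma zeros_anti {x y : Grid n 2} (h : x ≤ y) : zeros y ≤ zeros x := by
  simpa using twos_mono (reversal_le_reversal.2 h)

lemma rank_update (x : Grid n 2) (i : Fin n) (v : Fin (2 + 1)) :
    rank (Function.update x i v) + x i = rank x + v := by
  have e : ∀ j, ((Function.update x i v) j : ℕ)
      = Function.update (fun j => (x j : ℕ)) i (v : ℕ) j := by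
    intro j
    by_cases hj : j = i
    · subst hj; simp
    · simp [hj]
  rw [rank, sum_congr rfl fun j _ => e j, sum_update_of_mem (mem_univ i), rank,
    ← add_sum_erase univ (fun j => (x j : ℕ)) (mem_univ i), sdiff_singleton_eq_erase]
  omega

/-- The number of coordinates at which the larger of two elements is `2` and the other is not. -/
lemma card_filter_two_ne_two {x y : Grid n 2} (h : y ≤ x) :
    #{i | x i = 2 ∧ y i ≠ 2} + twos y = twos x := by
  rw [twos, twos, ← card_union_of_disjoint]
  · refine congrArg card (ext fun i => ?_)
    simp only [mem_union, mem_filter, mem_univ, true_and]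
    constructor
    · rintro (hi | hi)
      · exact hi.1
      · have := h i
        rw [hi] at this
        exact le_antisymm (Fin.le_last _) this
    · intro hi
      by_cases hy : y i = 2
      · exact Or.inr hy
      · exact Or.inl ⟨hi, hy⟩
  · refine disjoint_left.2 fun i hi hi' => ?_
    simp only [mem_filter, mem_univ, true_and] at hi hi'
    exact hi.2 hi'

/-- The number of coordinates at which the smaller of two elements is `0` and the other is not. -/
lemma card_filter_zero_ne_zero {x y : Grid n 2} (h : y ≤ x) :
    #{i | y i = 0 ∧ x i ≠ 0} + zeros x = zeros y := by
  have h1 := card_filter_two_ne_two (reversal_le_reversal.2 h)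
  simp only [twos_reversal] at h1
  rw [← h1]
  congr 2
  refine filter_congr fun i _ => ?_
  rcases fin_three_cases (x i) with hx | hx | hx <;>
    rcases fin_three_cases (y i) with hy | hy | hy <;> simp only [reversal, hx, hy] <;> decide

/-! ### Numbers of elements above and below -/

/-- The coefficient of `X ^ j` in `(1 + X + X ^ 2) ^ p * (1 + X) ^ q`. -/
noncomputable def cnt (p q j : ℕ) : ℕ := (((1 + X + X ^ 2) ^ p * (1 + X) ^ q : ℕ[X])).coeff j

/-- The elements `j` levels below `x`. -/
noncomputable def below (x : Grid n 2) (j : ℕ) : Finset (Grid n 2) :=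
  {z | z ≤ x ∧ rank z + j = rank x}

/-- The elements `j` levels above `x`. -/
noncomputable def above (x : Grid n 2) (j : ℕ) : Finset (Grid n 2) :=
  {z | x ≤ z ∧ rank z = rank x + j}

lemma mem_below {x z : Grid n 2} {j : ℕ} : z ∈ below x j ↔ z ≤ x ∧ rank z + j = rank x := by
  simp [below]

lemma mem_above {x z : Grid n 2} {j : ℕ} : z ∈ above x j ↔ x ≤ z ∧ rank z = rank x + j := by
  simp [above]

/-- The coordinates can be lowered independently, so the generating function by depth is a product
over coordinates, with factors 1 + X + X², 1 + X and 1 for the values 2, 1 and 0. -/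
lemma sum_X_pow_below (x : Grid n 2) :
    ∑ z ∈ Finset.univ.filter (· ≤ x), (X : ℕ[X]) ^ (rank x - rank z)
      = (1 + X + X ^ 2) ^ twos x * (1 + X) ^ ones x := by
  have h := prod_univ_sum (fun i => (univ.filter (· ≤ x i) : Finset (Fin (2 + 1))))
    (fun i v => (X : ℕ[X]) ^ ((x i : ℕ) - (v : ℕ)))
  have e1 : Fintype.piFinset (fun i => (univ.filter (· ≤ x i) : Finset (Fin (2 + 1))))
      = Finset.univ.filter (· ≤ x) := by
    ext z; simp [Pi.le_def]
  have e2 : ∀ z ∈ Finset.univ.filter (· ≤ x), ∏ i, (X : ℕ[X]) ^ ((x i : ℕ) - (z i : ℕ))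
      = X ^ (rank x - rank z) := by
    intro z hz
    have hz : z ≤ x := by simpa using hz
    rw [prod_pow_eq_pow_sum]
    congr 1
    rw [rank, rank, sum_tsub_distrib]
    exact fun i _ => Fin.le_def.1 (hz i)
  rw [e1, sum_congr rfl e2] at h
  rw [← h]
  have e3 : ∀ v : Fin (2 + 1), ∑ j ∈ (univ.filter (· ≤ v) : Finset (Fin (2 + 1))),
      (X : ℕ[X]) ^ ((v : ℕ) - (j : ℕ)) = (if v = 2 then 1 + X + X ^ 2 else 1)
        * (if v = 1 then 1 + X else 1) := by
    intro v
    rw [sum_filter, Fin.sum_univ_three]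
    rcases fin_three_cases v with h | h | h <;> subst h <;> simp <;> ring
  rw [prod_congr rfl fun i _ => e3 (x i), prod_mul_distrib, prod_ite, prod_ite]
  simp [twos, ones]

lemma card_below (x : Grid n 2) (j : ℕ) : #(below x j) = cnt (twos x) (ones x) j := by
  rw [cnt, ← sum_X_pow_below, finsetSum_coeff]
  simp only [coeff_X_pow]
  rw [← sum_filter, ← card_eq_sum_ones, filter_filter]
  refine congrArg card (filter_congr fun z _ => ?_)
  constructor
  · rintro ⟨h1, h2⟩
    exact ⟨h1, by omega⟩
  · rintro ⟨h1, h2⟩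
    have := rank_mono h1
    exact ⟨h1, by omega⟩

lemma card_image_reversal (s : Finset (Grid n 2)) : #(s.image reversal) = #s :=
  card_image_of_injective _ reversal_injective

lemma mem_image_reversal {s : Finset (Grid n 2)} {x : Grid n 2} :
    x ∈ s.image reversal ↔ reversal x ∈ s := by
  constructor
  · intro h
    obtain ⟨y, hy, rfl⟩ := mem_image.1 h
    simpa using hy
  · intro h
    exact mem_image.2 ⟨_, h, by simp⟩

lemma above_eq_image (x : Grid n 2) (j : ℕ) : above x j = (below (reversal x) j).image reversal := by
  ext z
  rw [mem_image_reversal, mem_above, mem_below, reversal_le_reversal]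
  have := rank_reversal x
  have := rank_reversal z
  refine and_congr_right fun _ => ?_
  omega

lemma card_above (x : Grid n 2) (j : ℕ) : #(above x j) = cnt (zeros x) (ones x) j := by
  rw [above_eq_image, card_image_reversal, card_below]
  simp

/-! ### Coefficientwise comparison of the counting polynomials -/

lemma coeff_mul_le_coeff_mul {p q r s : ℕ[X]} (h : ∀ j, p.coeff j ≤ q.coeff j)
    (h' : ∀ j, r.coeff j ≤ s.coeff j) (j : ℕ) : (p * r).coeff j ≤ (q * s).coeff j := by
  rw [coeff_mul, coeff_mul]
  exact sum_le_sum fun a _ => Nat.mul_le_mul (h _) (h' _)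

lemma coeff_pow_le_coeff_pow {p q : ℕ[X]} (h : ∀ j, p.coeff j ≤ q.coeff j) (m j : ℕ) :
    (p ^ m).coeff j ≤ (q ^ m).coeff j := by
  induction m generalizing j with
  | zero => simp
  | succ m ih => rw [pow_succ, pow_succ]; exact coeff_mul_le_coeff_mul ih h j

lemma coeff_one_le_coeff_pow {p : ℕ[X]} (h : ∀ j, (1 : ℕ[X]).coeff j ≤ p.coeff j) (m j : ℕ) :
    (1 : ℕ[X]).coeff j ≤ (p ^ m).coeff j := by
  simpa using coeff_pow_le_coeff_pow h m j

/-- Turning factors 1 + X into 1 + X + X², or adding factors, lowers no coefficient. All comparisons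
of up-degrees with down-degrees rest on this. -/
lemma cnt_le_cnt {p q p' q' : ℕ} (h1 : p ≤ p') (h2 : p + q ≤ p' + q') (j : ℕ) :
    cnt p q j ≤ cnt p' q' j := by
  obtain ⟨d, rfl⟩ := Nat.exists_eq_add_of_le h1
  have h3 : q ≤ d + q' := by omega
  obtain ⟨e, he⟩ := Nat.exists_eq_add_of_le h3
  rw [cnt, cnt, pow_add, mul_assoc]
  refine coeff_mul_le_coeff_mul (fun _ => le_rfl) (fun j => ?_) j
  calc ((1 + X : ℕ[X]) ^ q).coeff j ≤ ((1 + X : ℕ[X]) ^ q * (1 + X) ^ e).coeff j := by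
        simpa using coeff_mul_le_coeff_mul (p := (1 + X : ℕ[X]) ^ q) (fun _ => le_rfl)
          (coeff_one_le_coeff_pow (p := (1 + X : ℕ[X])) (fun j => by simp) e) j
    _ = ((1 + X : ℕ[X]) ^ d * (1 + X) ^ q').coeff j := by
        rw [← pow_add, ← pow_add, he]
    _ ≤ _ := coeff_mul_le_coeff_mul (coeff_pow_le_coeff_pow (fun j => by simp) d)
        (fun _ => le_rfl) j

lemma choose_le_cnt (p q j : ℕ) : (p + q).choose j ≤ cnt p q j := by
  have h := cnt_le_cnt (p := 0) (q := p + q) (p' := p) (q' := q) (by omega) (by omega) j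
  have e : cnt 0 (p + q) j = (p + q).choose j := by
    simp [cnt, add_comm (1 : ℕ[X]) X, coeff_X_add_one_pow]
  omega

lemma cnt_le_choose (p q j : ℕ) : cnt p q j ≤ (2 * p + q).choose j := by
  have e : ((1 + X) ^ (2 * p + q) : ℕ[X]).coeff j = (2 * p + q).choose j := by
    simp [add_comm (1 : ℕ[X]) X, coeff_X_add_one_pow]
  rw [← e, cnt, pow_add, pow_mul]
  refine coeff_mul_le_coeff_mul (coeff_pow_le_coeff_pow (fun j => ?_) p) (fun _ => le_rfl) j
  have : ((1 + X) ^ 2 : ℕ[X]) = 1 + X + X ^ 2 + X := by ring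
  rw [this, coeff_add _ X]
  omega

lemma cnt_zero_left (q j : ℕ) : cnt 0 q j = q.choose j := by
  simp [cnt, add_comm (1 : ℕ[X]) X, coeff_X_add_one_pow]

lemma cnt_zero (p q : ℕ) : cnt p q 0 = 1 := by
  simp [cnt, coeff_zero_eq_eval_zero]

lemma cnt_succ_left_one (p q : ℕ) : cnt (p + 1) q 1 = cnt p q 1 + cnt p q 0 := by
  have e : ((1 + X + X ^ 2) ^ (p + 1) * (1 + X) ^ q : ℕ[X])
      = (1 + X + X ^ 2) ^ p * (1 + X) ^ q + (1 + X + X ^ 2) ^ p * (1 + X) ^ q * X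
        + (1 + X + X ^ 2) ^ p * (1 + X) ^ q * X * X := by ring
  rw [cnt, e]
  simp [cnt, coeff_mul_X]

lemma cnt_succ_left (p q j : ℕ) :
    cnt (p + 1) q (j + 2) = cnt p q (j + 2) + cnt p q (j + 1) + cnt p q j := by
  have e : ((1 + X + X ^ 2) ^ (p + 1) * (1 + X) ^ q : ℕ[X])
      = (1 + X + X ^ 2) ^ p * (1 + X) ^ q + (1 + X + X ^ 2) ^ p * (1 + X) ^ q * X
        + (1 + X + X ^ 2) ^ p * (1 + X) ^ q * X * X := by ring
  rw [cnt, e]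
  simp [cnt, coeff_mul_X]

lemma cnt_succ_right (p q j : ℕ) : cnt p (q + 1) (j + 1) = cnt p q (j + 1) + cnt p q j := by
  have e : ((1 + X + X ^ 2) ^ p * (1 + X) ^ (q + 1) : ℕ[X])
      = (1 + X + X ^ 2) ^ p * (1 + X) ^ q + (1 + X + X ^ 2) ^ p * (1 + X) ^ q * X := by ring
  rw [cnt, e]
  simp [cnt, coeff_mul_X]

lemma cnt_one (p q : ℕ) : cnt p q 1 = p + q := by
  induction p with
  | zero => simp [cnt_zero_left]
  | succ p ih => rw [cnt_succ_left_one, ih, cnt_zero]; ring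

lemma cnt_two (p q : ℕ) : cnt p q 2 = (p + q).choose 2 + p := by
  induction p with
  | zero => simp [cnt_zero_left]
  | succ p ih =>
    rw [cnt_succ_left, ih, cnt_one, cnt_zero, show p + 1 + q = p + q + 1 by ring,
      Nat.choose_succ_succ' (p + q) 1, Nat.choose_one_right]
    ring

/-- Above the middle, `x` has at least as many elements `j` levels below it as any `y ≤ x` has
`j` levels above it. -/
lemma card_above_le_card_below {x y : Grid n 2} (h : y ≤ x) (hy : n ≤ rank y) (j : ℕ) :
    #(above y j) ≤ #(below x j) := by
  rw [card_above, card_below]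
  have := rank_add_zeros y
  have := zeros_add_ones_add_twos x
  have := zeros_add_ones_add_twos y
  have := twos_mono h
  have := zeros_anti h
  exact cnt_le_cnt (by omega) (by omega) j

/-! ### A weighted matching in a bipartite graph -/

lemma exists_injOn_of_hall {α β : Type*} [Nonempty β] (T : Finset α) (Y : Finset β) (r : α → β → Prop)
    (h : ∀ A ⊆ T, #A ≤ #{y ∈ Y | ∃ x ∈ A, r x y}) :
    ∃ φ : α → β, Set.InjOn φ T ∧ ∀ x ∈ T, φ x ∈ Y ∧ r x (φ x) := by
  have hall := (all_card_le_biUnion_card_iff_exists_injective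
    (fun x : {x // x ∈ T} => Y.filter (r x.1))).1 (fun s => by
      have h1 := h (s.map (Function.Embedding.subtype _)) (fun a ha => by
        obtain ⟨b, -, rfl⟩ := mem_map.1 ha
        exact b.2)
      rw [card_map] at h1
      refine h1.trans (card_le_card fun y hy => ?_)
      simp only [mem_filter, mem_map, Function.Embedding.subtype_apply] at hy
      obtain ⟨hy, x, ⟨a, ha, rfl⟩, hr⟩ := hy
      exact mem_biUnion.2 ⟨a, ha, mem_filter.2 ⟨hy, hr⟩⟩)
  obtain ⟨φ, hφ, hm⟩ := hall
  refine ⟨fun x => if hx : x ∈ T then φ ⟨x, hx⟩ else Classical.arbitrary β, ?_, ?_⟩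
  · intro a ha b hb hab
    have ha : a ∈ T := ha
    have hb : b ∈ T := hb
    simp only [ha, hb, dite_true] at hab
    simpa using hφ hab
  · intro x hx
    simp only [hx, dite_true]
    exact mem_filter.1 (hm ⟨x, hx⟩)

/-- A König-type argument: the matching saturates a vertex cover, so all edges can be charged to
matched vertices. The weights f and g bound the degrees, and since g ≤ f along edges the charge can
be moved to the left end of each matched pair. -/
lemma exists_matching {α β : Type*} [Nonempty α] [Nonempty β] (T : Finset α) (Y : Finset β) (r : α → β → Prop)
    (f : α → ℕ) (g : β → ℕ) (hf : ∀ x ∈ T, #{y ∈ Y | r x y} ≤ f x)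
    (hg : ∀ y ∈ Y, #{x ∈ T | r x y} ≤ g y) (hfg : ∀ x ∈ T, ∀ y ∈ Y, r x y → g y ≤ f x) :
    ∃ P : Finset (α × β), (∀ p ∈ P, p.1 ∈ T ∧ p.2 ∈ Y ∧ r p.1 p.2) ∧
      Set.InjOn Prod.fst (P : Set (α × β)) ∧ Set.InjOn Prod.snd (P : Set (α × β)) ∧
      ∑ x ∈ T, #{y ∈ Y | r x y} ≤ ∑ p ∈ P, f p.1 := by
  let N : Finset α → Finset β := fun S => {y ∈ Y | ∃ x ∈ S, r x y}
  -- S has maximal deficiency. By maximality Hall's condition holds from T \ S into Y \ N S, and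
  -- also from N S into S; together T \ S and N S cover every edge.
  obtain ⟨S, hS, hmax⟩ := exists_max_image T.powerset (fun S => (#S : ℤ) - #(N S)) ⟨∅, by simp⟩
  rw [mem_powerset] at hS
  obtain ⟨φ, hφ, hφm⟩ := exists_injOn_of_hall (T \ S) (Y \ N S) r (by
    intro A hA
    have h1 := hmax (S ∪ A) (mem_powerset.2 (union_subset hS (hA.trans sdiff_subset)))
    have h2 : #(S ∪ A) = #S + #A := card_union_of_disjoint
      (disjoint_left.2 fun a ha hb => (mem_sdiff.1 (hA hb)).2 ha)
    have h3 : #(N (S ∪ A)) ≤ #(N S) + #{y ∈ Y \ N S | ∃ x ∈ A, r x y} := by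
      refine (card_le_card fun y hy => ?_).trans (card_union_le _ _)
      simp only [N, mem_filter, mem_union, mem_sdiff] at hy ⊢
      obtain ⟨hy, x, hx, hr⟩ := hy
      by_cases hn : ∃ x ∈ S, r x y
      · exact Or.inl ⟨hy, hn⟩
      · exact Or.inr ⟨⟨hy, fun h => hn h.2⟩, x, hx.resolve_left fun h => hn ⟨x, h, hr⟩, hr⟩
    have h1 : ((#S + #A : ℕ) : ℤ) - #(N (S ∪ A)) ≤ #S - #(N S) := by simpa [h2] using h1
    omega)
  obtain ⟨ψ, hψ, hψm⟩ := exists_injOn_of_hall (N S) S (fun y x => r x y) (by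
    intro B hB
    have h1 := hmax (S.filter fun x => ¬ ∃ y ∈ B, r x y) (mem_powerset.2 ((filter_subset _ _).trans hS))
    have h2 := card_filter_add_card_filter_not (s := S) (fun x => ∃ y ∈ B, r x y)
    have h3 : #(N (S.filter fun x => ¬ ∃ y ∈ B, r x y)) + #B ≤ #(N S) := by
      rw [← card_union_of_disjoint]
      · refine card_le_card (union_subset (fun y hy => ?_) hB)
        simp only [N, mem_filter] at hy ⊢
        obtain ⟨hy, x, hx, hr⟩ := hy
        exact ⟨hy, x, hx.1, hr⟩
      · refine disjoint_left.2 fun y hy hb => ?_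
        simp only [N, mem_filter] at hy
        obtain ⟨hy, x, hx, hr⟩ := hy
        exact hx.2 ⟨y, hb, hr⟩
    omega)
  have hdisj : Disjoint ((T \ S).image fun x => (x, φ x)) ((N S).image fun y => (ψ y, y)) := by
    rw [disjoint_left]
    intro p hp hq
    obtain ⟨x, hx, rfl⟩ := mem_image.1 hp
    obtain ⟨y, hy, he⟩ := mem_image.1 hq
    rw [Prod.mk.injEq] at he
    exact (mem_sdiff.1 hx).2 (he.1 ▸ (hψm y hy).1)
  refine ⟨(T \ S).image (fun x => (x, φ x)) ∪ (N S).image (fun y => (ψ y, y)), ?_, ?_, ?_, ?_⟩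
  · intro p hp
    rcases mem_union.1 hp with hp | hp
    · obtain ⟨x, hx, rfl⟩ := mem_image.1 hp
      exact ⟨(mem_sdiff.1 hx).1, (mem_sdiff.1 (hφm x hx).1).1, (hφm x hx).2⟩
    · obtain ⟨y, hy, rfl⟩ := mem_image.1 hp
      exact ⟨hS (hψm y hy).1, (mem_filter.1 hy).1, (hψm y hy).2⟩
  · intro p hp q hq hpq
    rcases mem_union.1 (mem_coe.1 hp) with hp | hp <;> rcases mem_union.1 (mem_coe.1 hq) with hq | hq <;>
      obtain ⟨x, hx, rfl⟩ := mem_image.1 hp <;> obtain ⟨y, hy, rfl⟩ := mem_image.1 hq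
    · simp only at hpq
      rw [hpq]
    · simp only at hpq
      exact absurd (hpq ▸ (hψm y hy).1) (mem_sdiff.1 hx).2
    · simp only at hpq
      exact absurd (hpq ▸ (hψm x hx).1) (mem_sdiff.1 hy).2
    · simp only at hpq
      rw [hψ hx hy hpq]
  · intro p hp q hq hpq
    rcases mem_union.1 (mem_coe.1 hp) with hp | hp <;> rcases mem_union.1 (mem_coe.1 hq) with hq | hq <;>
      obtain ⟨x, hx, rfl⟩ := mem_image.1 hp <;> obtain ⟨y, hy, rfl⟩ := mem_image.1 hq
    · simp only at hpq
      rw [hφ hx hy hpq]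
    · simp only at hpq
      exact absurd (hpq ▸ hy) (mem_sdiff.1 (hφm x hx).1).2
    · simp only at hpq
      exact absurd (hpq ▸ hx) (mem_sdiff.1 (hφm y hy).1).2
    · simp only at hpq
      rw [hpq]
  · rw [sum_union hdisj, sum_image (fun a _ b _ h => (Prod.mk.inj h).1),
      sum_image (fun a _ b _ h => (Prod.mk.inj h).2), ← sum_sdiff hS]
    refine add_le_add (sum_le_sum fun x hx => hf x (mem_sdiff.1 hx).1) ?_
    -- Edges leaving S end in N S, so they are counted from there and charged to the partners of N S
    -- in S.
    have e : ∀ x ∈ S, #{y ∈ Y | r x y} = #(bipartiteAbove r (N S) x) := by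
      intro x hx
      refine congrArg card (ext fun y => ?_)
      simp only [mem_filter, bipartiteAbove, N]
      exact ⟨fun h => ⟨⟨h.1, x, hx, h.2⟩, h.2⟩, fun h => ⟨h.1.1, h.2⟩⟩
    rw [sum_congr rfl e, sum_card_bipartiteAbove_eq_sum_card_bipartiteBelow]
    refine sum_le_sum fun y hy => ?_
    have hyY := (mem_filter.1 hy).1
    calc _ ≤ #{x ∈ T | r x y} := card_le_card (filter_subset_filter _ hS)
      _ ≤ g y := hg y hyY
      _ ≤ _ := hfg _ (hS (hψm y hy).1) y hyY (hψm y hy).2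

/-! ### Comparable pairs -/

/-- The number of members of `G` comparable to and distinct from `x`. -/
noncomputable def deg (G : Finset (Grid n 2)) (x : Grid n 2) : ℕ := #{z ∈ G | z < x ∨ x < z}

lemma comp_eq_sum (F : Finset (Grid n 2)) :
    comp F = ∑ a ∈ F, ∑ b ∈ F, if a < b then 1 else 0 := by
  rw [comp, card_filter, sum_product]

lemma deg_eq_sum (G : Finset (Grid n 2)) (x : Grid n 2) :
    deg G x = ∑ z ∈ G, ((if z < x then 1 else 0) + if x < z then 1 else 0) := by
  rw [deg, card_filter]
  refine sum_congr rfl fun z _ => ?_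
  by_cases h1 : z < x
  · simp [h1, h1.not_gt]
  · simp [h1]

lemma comp_union {G R : Finset (Grid n 2)} (h : Disjoint G R) :
    comp (G ∪ R) = comp G + ∑ x ∈ R, deg G x + comp R := by
  simp only [comp_eq_sum, deg_eq_sum, sum_union h, sum_add_distrib]
  rw [sum_comm (s := R) (t := G) (f := fun x z => if z < x then 1 else 0)]
  ring

lemma comp_eq_zero {R : Finset (Grid n 2)} {r : ℕ} (h : ∀ x ∈ R, rank x = r) : comp R = 0 := by
  rw [comp, card_eq_zero, filter_eq_empty_iff]
  rintro ⟨a, b⟩ hab hlt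
  obtain ⟨ha, hb⟩ := mem_product.1 hab
  have := rank_strictMono hlt
  have := h _ ha
  have := h _ hb
  simp only at *
  omega

/-! ### Closedness of optimal families -/

/-- The total distance of the members of `F` from the middle rank. -/
def spread (F : Finset (Grid n 2)) : ℕ := ∑ x ∈ F, ((rank x - n) + (n - rank x))

/-- Below each of its members above the middle, `F` contains everything down to the middle. -/
def UpperClosed (F : Finset (Grid n 2)) : Prop :=
  ∀ x ∈ F, ∀ y, y < x → n ≤ rank y → y ∈ F

lemma card_filter_rank_Ioo_above (y : Grid n 2) (t : ℕ) :
    #{z | y < z ∧ rank z < t} = ∑ j ∈ Ioo 0 (t - rank y), #(above y j) := by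
  rw [card_eq_sum_card_fiberwise (f := fun z => rank z - rank y) (t := Ioo 0 (t - rank y))]
  · refine sum_congr rfl fun j hj => congrArg card (ext fun z => ?_)
    rw [mem_Ioo] at hj
    simp only [mem_filter, mem_univ, true_and, mem_above]
    constructor
    · rintro ⟨⟨h1, h2⟩, h3⟩
      have := rank_strictMono h1
      exact ⟨h1.le, by omega⟩
    · rintro ⟨h1, h2⟩
      refine ⟨⟨lt_of_le_of_ne h1 fun h => ?_, by omega⟩, by omega⟩
      subst h; omega
  · intro z hz
    simp only [coe_filter, mem_univ, true_and, Set.mem_ofPred_eq] at hz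
    have := rank_strictMono hz.1
    simp only [coe_Ioo, Set.mem_Ioo]
    omega

lemma card_filter_rank_Ioo_below (x : Grid n 2) (u : ℕ) :
    #{z | z < x ∧ u < rank z} = ∑ j ∈ Ioo 0 (rank x - u), #(below x j) := by
  rw [card_eq_sum_card_fiberwise (f := fun z => rank x - rank z) (t := Ioo 0 (rank x - u))]
  · refine sum_congr rfl fun j hj => congrArg card (ext fun z => ?_)
    rw [mem_Ioo] at hj
    simp only [mem_filter, mem_univ, true_and, mem_below]
    constructor
    · rintro ⟨⟨h1, h2⟩, h3⟩
      have := rank_strictMono h1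
      exact ⟨h1.le, by omega⟩
    · rintro ⟨h1, h2⟩
      refine ⟨⟨lt_of_le_of_ne h1 fun h => ?_, by omega⟩, by omega⟩
      subst h; omega
  · intro z hz
    simp only [coe_filter, mem_univ, true_and, Set.mem_ofPred_eq] at hz
    have := rank_strictMono hz.1
    simp only [coe_Ioo, Set.mem_Ioo]
    omega

/-- Elements of a family can be pushed down to missing elements of rank `u ≥ n`. -/
lemma exists_push {F : Finset (Grid n 2)} {t u : ℕ} (hu : n ≤ u) (hut : u < t)
    (habove : ∀ v ∈ F, t < rank v → ∀ y, y < v → n ≤ rank y → y ∈ F)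
    (hmid : ∀ x ∈ F, rank x = t → ∀ y, y < x → u < rank y → y ∈ F)
    (hex : ∃ x ∈ F, rank x = t ∧ ∃ y, y < x ∧ rank y = u ∧ y ∉ F) :
    ∃ F' : Finset (Grid n 2), #F' = #F ∧ comp F' ≤ comp F ∧ spread F' < spread F := by
  let T := F.filter fun x => rank x = t
  let Y : Finset (Grid n 2) := univ.filter fun y => rank y = u ∧ y ∉ F
  obtain ⟨P, hP, hinj1, hinj2, hsum⟩ := exists_matching T Y (fun x y => y < x)
    (fun x => #(below x (t - u))) (fun y => #(above y (t - u)))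
    (fun x hx => card_le_card fun y hy => by
      have h1 := (mem_filter.1 hx).2
      simp only [Y, mem_filter, mem_univ, true_and] at hy
      exact mem_below.2 ⟨hy.2.le, by omega⟩)
    (fun y hy => card_le_card fun x hx => by
      have h1 := (mem_filter.1 hy).2.1
      simp only [T, mem_filter] at hx
      exact mem_above.2 ⟨hx.2.le, by omega⟩)
    (fun x hx y hy hlt => by
      have h1 := (mem_filter.1 hy).2.1
      exact card_above_le_card_below hlt.le (by omega) _)
  let R := P.image Prod.fst
  let Q := P.image Prod.snd
  have hRT : R ⊆ T := fun x hx => by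
    obtain ⟨p, hp, rfl⟩ := mem_image.1 hx
    exact (hP p hp).1
  have hQY : Q ⊆ Y := fun x hx => by
    obtain ⟨p, hp, rfl⟩ := mem_image.1 hx
    exact (hP p hp).2.1
  have hRF : R ⊆ F := hRT.trans (filter_subset _ _)
  have hRt : ∀ x ∈ R, rank x = t := fun x hx => (mem_filter.1 (hRT hx)).2
  have hQu : ∀ x ∈ Q, rank x = u := fun x hx => (mem_filter.1 (hQY hx)).2.1
  have hQF : ∀ x ∈ Q, x ∉ F := fun x hx => (mem_filter.1 (hQY hx)).2.2
  have hRc : #R = #P := card_image_of_injOn hinj1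
  have hQc : #Q = #P := card_image_of_injOn hinj2
  -- There is at least one edge between T and Y, so the matching inequality forbids an empty
  -- matching; this makes the decrease of the spread strict.
  have hPne : 0 < #P := by
    rw [card_pos, nonempty_iff_ne_empty]
    intro hPe
    rw [hPe, sum_empty, Nat.le_zero, sum_eq_zero_iff] at hsum
    obtain ⟨x, hx, hxt, y, hyx, hyu, hyF⟩ := hex
    have h1 := hsum x (mem_filter.2 ⟨hx, hxt⟩)
    rw [card_eq_zero] at h1
    exact notMem_empty y (h1 ▸ mem_filter.2 ⟨mem_filter.2 ⟨mem_univ _, hyu, hyF⟩, hyx⟩)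
  let G := F \ R
  have hGR : Disjoint G R := sdiff_disjoint
  have hGQ : Disjoint G Q := disjoint_left.2 fun x hx hq => hQF x hq (mem_sdiff.1 hx).1
  have hFeq : F = G ∪ R := (sdiff_union_of_subset hRF).symm
  refine ⟨G ∪ Q, ?_, ?_, ?_⟩
  · rw [card_union_of_disjoint hGQ, hFeq, card_union_of_disjoint hGR, hRc, hQc]
  · rw [hFeq, comp_union hGQ, comp_union hGR, comp_eq_zero hRt, comp_eq_zero hQu]
    have h0 : ∑ y ∈ Q, deg G y ≤ ∑ x ∈ R, deg G x := by
      rw [sum_image (fun a ha b hb => hinj1 ha hb), sum_image (fun a ha b hb => hinj2 ha hb)]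
      -- local comparison along each matched pair
      have hloc : ∀ p ∈ P, deg G p.2 + #(below p.1 (t - u))
          ≤ deg G p.1 + #{x ∈ T \ R | p.2 < x} + #{y ∈ Y | y < p.1} := by
        rintro ⟨x, y⟩ hp
        obtain ⟨hx, hy, hlt⟩ := hP _ hp
        simp only at hx hy hlt ⊢
        obtain ⟨hxF, hxt⟩ := mem_filter.1 hx
        obtain ⟨-, hyu, hyF⟩ := mem_filter.1 hy
        have hA : deg G y ≤ #{z ∈ G | z < y} + #{z | y < z ∧ rank z < t}
            + #{x ∈ T \ R | y < x} := by
          rw [deg]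
          refine (card_le_card fun z hz => ?_).trans
            ((card_union_le ({z ∈ G | z < y} ∪ ({z | y < z ∧ rank z < t} : Finset (Grid n 2)))
              {x ∈ T \ R | y < x}).trans (add_le_add_left (card_union_le _ _) _))
          obtain ⟨hzG, hz⟩ := mem_filter.1 hz
          obtain ⟨hzF, hzR⟩ := mem_sdiff.1 hzG
          simp only [mem_union, mem_filter, mem_univ, true_and, mem_sdiff, T]
          rcases hz with hz | hz
          · exact Or.inl (Or.inl ⟨hzG, hz⟩)
          · rcases lt_trichotomy (rank z) t with h | h | h
            · exact Or.inl (Or.inr ⟨hz, h⟩)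
            · exact Or.inr ⟨⟨⟨hzF, h⟩, hzR⟩, hz⟩
            · exact absurd (habove z hzF h y hz (by omega)) hyF
        have hB : #{z ∈ G | z < y} + #{z | z < x ∧ u < rank z} + #{z ∈ F | z < x ∧ rank z = u}
            ≤ deg G x := by
          rw [deg, ← card_union_of_disjoint, ← card_union_of_disjoint]
          · refine card_le_card fun z hz => ?_
            simp only [mem_union, mem_filter, mem_univ, true_and] at hz
            rcases hz with (hz | hz) | hz
            · exact mem_filter.2 ⟨hz.1, Or.inl (hz.2.trans hlt)⟩
            · refine mem_filter.2 ⟨mem_sdiff.2 ⟨hmid x hxF hxt z hz.1 hz.2, fun h => ?_⟩, Or.inl hz.1⟩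
              have := hRt z h
              have := rank_strictMono hz.1
              omega
            · refine mem_filter.2 ⟨mem_sdiff.2 ⟨hz.1, fun h => ?_⟩, Or.inl hz.2.1⟩
              have := hRt z h
              omega
          · refine disjoint_left.2 fun z hz hz' => ?_
            simp only [mem_union, mem_filter, mem_univ, true_and] at hz hz'
            rcases hz with hz | hz
            · have := rank_strictMono hz.2
              omega
            · omega
          · refine disjoint_left.2 fun z hz hz' => ?_
            simp only [mem_filter, mem_univ, true_and] at hz hz'
            have := rank_strictMono hz.2
            omega
        -- The levels strictly between u and t: what y may gain there is dominated level by level by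
        -- what x loses, all of the latter lying in F by `hmid`.
        have hC : #{z | y < z ∧ rank z < t} ≤ #{z | z < x ∧ u < rank z} := by
          rw [card_filter_rank_Ioo_above, card_filter_rank_Ioo_below, hyu, hxt]
          exact sum_le_sum fun j _ => card_above_le_card_below hlt.le (by omega) j
        have hD : #(below x (t - u)) ≤ #{z ∈ F | z < x ∧ rank z = u} + #{y ∈ Y | y < x} := by
          refine (card_le_card fun z hz => ?_).trans (card_union_le _ _)
          obtain ⟨h1, h2⟩ := mem_below.1 hz
          have hlt' : z < x := lt_of_le_of_ne h1 fun h => by subst h; omega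
          simp only [mem_union, mem_filter, mem_univ, true_and, Y]
          by_cases hzF : z ∈ F
          · exact Or.inl ⟨hzF, hlt', by omega⟩
          · exact Or.inr ⟨⟨by omega, hzF⟩, hlt'⟩
        omega
      -- The two error terms count edges of the graph between T and Y, the former with left end
      -- outside R and the latter with left end in R. Hence no edge is counted twice, and the
      -- matching inequality absorbs both.
      have hedge : ∑ p ∈ P, #{x ∈ T \ R | p.2 < x} + ∑ p ∈ P, #{y ∈ Y | y < p.1}
          ≤ ∑ x ∈ T, #{y ∈ Y | y < x} := by
        rw [← sum_sdiff hRT]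
        refine add_le_add ?_ ?_
        · rw [← sum_image (s := P) (g := Prod.snd) (f := fun y => #{x ∈ T \ R | y < x})
            (fun a ha b hb => hinj2 ha hb)]
          calc ∑ y ∈ Q, #{x ∈ T \ R | y < x}
              = ∑ x ∈ T \ R, #{y ∈ Q | y < x} :=
                (sum_card_bipartiteAbove_eq_sum_card_bipartiteBelow (fun x y => y < x)).symm
            _ ≤ _ := sum_le_sum fun x _ => card_le_card (filter_subset_filter _ hQY)
        · rw [← sum_image (s := P) (g := Prod.fst) (f := fun x => #{y ∈ Y | y < x})
            (fun a ha b hb => hinj1 ha hb)]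
      have := sum_le_sum hloc
      simp only [sum_add_distrib] at this
      omega
    omega
  · have h1 : ∑ x ∈ R, ((rank x - n) + (n - rank x)) = #P * (t - n) := by
      rw [← hRc]
      exact sum_const_nat fun x hx => by rw [hRt x hx]; omega
    have h2 : ∑ x ∈ Q, ((rank x - n) + (n - rank x)) = #P * (u - n) := by
      rw [← hQc]
      exact sum_const_nat fun x hx => by rw [hQu x hx]; omega
    rw [hFeq, spread, spread, sum_union hGQ, sum_union hGR, add_lt_add_iff_left, h1, h2]
    exact Nat.mul_lt_mul_of_pos_left (by omega) hPne

/-- `F` has no modification of the same size that has no more comparable pairs and is closer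
to the middle. -/
def IsTight (F : Finset (Grid n 2)) : Prop :=
  ∀ F' : Finset (Grid n 2), #F' = #F → comp F' ≤ comp F → spread F ≤ spread F'

/-- Among the violating pairs one takes x of largest rank and then y of largest rank; then
everything above and between is already closed, which is what `exists_push` requires. -/
lemma IsTight.upperClosed {F : Finset (Grid n 2)} (hF : IsTight F) : UpperClosed F := by
  by_contra hcon
  simp only [UpperClosed, not_forall] at hcon
  obtain ⟨x0, hx0, y0, hlt0, hn0, hy0⟩ := hcon
  obtain ⟨⟨x, y⟩, hxy, hmax⟩ := exists_max_image
    ((univ : Finset (Grid n 2 × Grid n 2)).filter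
      fun p => p.1 ∈ F ∧ p.2 < p.1 ∧ n ≤ rank p.2 ∧ p.2 ∉ F)
    -- Ranks are at most 2n, so this encodes the lexicographic order on pairs of ranks.
    (fun p => rank p.1 * (2 * n + 1) + rank p.2) ⟨(x0, y0), by simp [*]⟩
  simp only [mem_filter, mem_univ, true_and] at hxy
  obtain ⟨hx, hlt, hn, hy⟩ := hxy
  obtain ⟨F', h1, h2, h3⟩ := exists_push (F := F) hn (rank_strictMono hlt)
    (fun v hv hvt z hz hzn => by
      by_contra hzF
      have := hmax (v, z) (by simp [*])
      simp only at this
      have h4 := rank_le y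
      nlinarith)
    (fun v hv hvt z hz hzn => by
      by_contra hzF
      have := hmax (v, z) (by simp [*]; omega)
      simp only [hvt] at this
      omega)
    ⟨x, hx, rfl, y, hlt, rfl, hy⟩
  have := hF F' h1 h2
  omega

lemma comp_image_reversal (F : Finset (Grid n 2)) : comp (F.image reversal) = comp F := by
  rw [comp_eq_sum, comp_eq_sum, sum_image reversal_injective.injOn, sum_comm (s := F) (t := F)]
  refine sum_congr rfl fun a _ => ?_
  rw [sum_image reversal_injective.injOn]
  simp

lemma spread_image_reversal (F : Finset (Grid n 2)) : spread (F.image reversal) = spread F := by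
  have h := sum_image (s := F) (g := reversal) (f := fun x => (rank x - n) + (n - rank x))
    reversal_injective.injOn
  rw [spread, spread, h]
  refine sum_congr rfl fun x _ => ?_
  have := rank_reversal x
  omega

lemma IsTight.image_reversal {F : Finset (Grid n 2)} (hF : IsTight F) :
    IsTight (F.image reversal) := by
  intro F' h1 h2
  rw [spread_image_reversal, ← spread_image_reversal F']
  refine hF _ ?_ ?_
  · rw [card_image_reversal, h1, card_image_reversal]
  · rw [comp_image_reversal]
    rwa [comp_image_reversal] at h2

/-- By closedness from both sides, a missing element of rank n is comparable to no member.
Exchanging a member off the middle for it would reduce the spread at no cost. -/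
lemma IsTight.layer_subset {F : Finset (Grid n 2)} (hF : IsTight F)
    (hcard : #(layer n 2 n) ≤ #F) : layer n 2 n ⊆ F := by
  intro y hy
  have hyn : rank y = n := (mem_filter.1 hy).2
  by_contra hyF
  obtain ⟨A, hA, hAn⟩ : ∃ A ∈ F, rank A ≠ n := by
    by_contra hcon
    push Not at hcon
    have hsub : F ⊆ (layer n 2 n).erase y := fun A hA =>
      mem_erase.2 ⟨fun h => hyF (h ▸ hA), mem_filter.2 ⟨mem_univ _, hcon A hA⟩⟩
    have := card_le_card hsub
    rw [card_erase_of_mem hy] at this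
    have : 0 < #(layer n 2 n) := card_pos.2 ⟨y, hy⟩
    omega
  have hup := hF.upperClosed
  have hdown := hF.image_reversal.upperClosed
  have hdeg : deg (F.erase A) y = 0 := by
    rw [deg, card_eq_zero, filter_eq_empty_iff]
    rintro z hz (h | h)
    · have h3 := hdown (reversal z) (mem_image_reversal.2 (by simpa using (mem_erase.1 hz).2))
        (reversal y) (by simpa using h) (by have := rank_reversal y; omega)
      exact hyF (by simpa using mem_image_reversal.1 h3)
    · exact hyF (hup z (mem_erase.1 hz).2 y h hyn.ge)
  have hyE : Disjoint (F.erase A) {y} := disjoint_singleton_right.2 fun h => hyF (mem_erase.1 h).2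
  have hAE : Disjoint (F.erase A) {A} := disjoint_singleton_right.2 fun h => (mem_erase.1 h).1 rfl
  have hFeq : F = F.erase A ∪ {A} := by
    ext z; by_cases h : z = A <;> simp [h, hA]
  have h1 := hF (F.erase A ∪ {y}) (by
      conv_rhs => rw [hFeq]
      rw [card_union_of_disjoint hyE, card_union_of_disjoint hAE]; simp) (by
      conv_rhs => rw [hFeq]
      rw [comp_union hyE, comp_union hAE, sum_singleton, hdeg,
        comp_eq_zero (R := {y}) (r := n) (by simpa using hyn)]
      omega)
  conv_lhs at h1 => rw [hFeq]
  rw [spread, spread, sum_union hyE, sum_union hAE, sum_singleton, sum_singleton] at h1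
  omega

/-- Minimise the number of comparable pairs, then the spread among the minimisers. -/
lemma exists_isOptimal_isTight {M : ℕ} (hM : M ≤ Fintype.card (Grid n 2)) :
    ∃ F : Finset (Grid n 2), IsOptimal M F ∧ IsTight F := by
  obtain ⟨F0, -, hF0⟩ := exists_subset_card_eq (s := (univ : Finset (Grid n 2))) (n := M) (by simpa using hM)
  obtain ⟨F1, hF1, hmin1⟩ := exists_min_image
    ((univ : Finset (Finset (Grid n 2))).filter fun F => #F = M) comp ⟨F0, by simp [hF0]⟩
  obtain ⟨F, hF, hmin⟩ := exists_min_image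
    ((univ : Finset (Finset (Grid n 2))).filter fun F => #F = M ∧ comp F ≤ comp F1) spread
    ⟨F1, by simpa using hF1⟩
  simp only [mem_filter, mem_univ, true_and] at *
  refine ⟨F, ⟨hF.1, fun F' h => hF.2.trans (hmin1 F' h)⟩, fun F' h1 h2 => ?_⟩
  exact hmin F' ⟨h1.trans hF.1, h2.trans hF.2⟩

/-! ### A flow from rank `n + 2` to rank `n - 1` -/

/-- `y` arises from `x` by changing one coordinate from `u` to `v`. -/
def Changes (u v : Fin (2 + 1)) (x y : Grid n 2) : Prop := ∃ i, x i = u ∧ y = Function.update x i v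

lemma Changes.symm {u v : Fin (2 + 1)} {x y : Grid n 2} (h : Changes u v x y) : Changes v u y x := by
  obtain ⟨i, rfl, rfl⟩ := h
  exact ⟨i, by simp, by simp⟩

lemma changes_comm {u v : Fin (2 + 1)} {x y : Grid n 2} : Changes u v x y ↔ Changes v u y x :=
  ⟨Changes.symm, Changes.symm⟩

lemma card_changes {u v : Fin (2 + 1)} (huv : u ≠ v) (x : Grid n 2) :
    #{y | Changes u v x y} = #{i | x i = u} := by
  symm
  refine card_bij (fun i _ => Function.update x i v) ?_ ?_ ?_
  · intro i hi
    simp only [mem_filter, mem_univ, true_and] at hi ⊢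
    exact ⟨i, hi, rfl⟩
  · intro i hi j hj hij
    simp only [mem_filter, mem_univ, true_and] at hi hj
    by_contra hne
    have := congrFun hij i
    simp [Function.update_of_ne hne, hi, huv.symm] at this
  · intro y hy
    simp only [mem_filter, mem_univ, true_and] at hy
    obtain ⟨i, hi, rfl⟩ := hy
    exact ⟨i, by simpa using hi, rfl⟩

lemma Changes.rank_add {u v : Fin (2 + 1)} {x y : Grid n 2} (h : Changes u v x y) :
    rank y + u = rank x + v := by
  obtain ⟨i, rfl, rfl⟩ := h
  exact rank_update x i v

lemma Changes.le {u v : Fin (2 + 1)} {x y : Grid n 2} (h : Changes u v x y) (huv : v ≤ u) :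
    y ≤ x := by
  obtain ⟨i, rfl, rfl⟩ := h
  intro j
  by_cases hj : j = i
  · subst hj; simpa using huv
  · simp [hj]

lemma Changes.card_filter {u v : Fin (2 + 1)} {x y : Grid n 2} (h : Changes u v x y)
    (w : Fin (2 + 1)) : #{j | y j = w} + (if u = w then 1 else 0)
      = #{j | x j = w} + (if v = w then 1 else 0) := by
  obtain ⟨i, rfl, rfl⟩ := h
  simp only [Finset.card_filter]
  rw [← add_sum_erase univ _ (mem_univ i), ← add_sum_erase univ (fun j => if x j = w then 1 else 0)
    (mem_univ i)]
  have : ∑ j ∈ univ.erase i, (if Function.update x i v j = w then 1 else 0)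
      = ∑ j ∈ univ.erase i, if x j = w then 1 else 0 :=
    sum_congr rfl fun j hj => by rw [Function.update_of_ne (ne_of_mem_erase hj)]
  rw [this, Function.update_self]
  ring

lemma mem_below_one {x y : Grid n 2} : y ∈ below x 1 ↔ Changes 2 1 x y ∨ Changes 1 0 x y := by
  constructor
  · intro h
    obtain ⟨hle, hr⟩ := mem_below.1 h
    have hlt : y < x := lt_of_le_of_ne hle fun h => by subst h; omega
    obtain ⟨-, i, hi⟩ := Pi.lt_def.1 hlt
    have key : ∀ v : Fin (2 + 1), y i ≤ v → (v : ℕ) + 1 = x i → y = Function.update x i v := by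
      intro v hv hvx
      have := rank_update x i v
      refine eq_of_le_of_rank_eq (fun j => ?_) (by omega)
      by_cases hj : j = i
      · subst hj; simpa using hv
      · simpa [hj] using hle j
    rcases fin_three_cases (x i) with hx | hx | hx
    · rw [hx] at hi; exact absurd hi (by simp)
    · right
      refine ⟨i, hx, key 0 ?_ (by simp [hx])⟩
      rw [hx] at hi
      revert hi; generalize y i = v; revert v; decide
    · left
      refine ⟨i, hx, key 1 ?_ (by simp [hx])⟩
      rw [hx] at hi
      revert hi; generalize y i = v; revert v; decide
  · rintro (h | h)
    · exact mem_below.2 ⟨h.le (by decide), by have := h.rank_add; simp at this; omega⟩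
    · exact mem_below.2 ⟨h.le (by decide), by have := h.rank_add; simp at this; omega⟩

lemma Changes.two_one {x y : Grid n 2} (h : Changes 2 1 x y) :
    zeros y = zeros x ∧ ones y = ones x + 1 ∧ twos y + 1 = twos x := by
  have h0 := h.card_filter 0
  have h1 := h.card_filter 1
  have h2 := h.card_filter 2
  simp at h0 h1 h2
  exact ⟨h0, h1, h2⟩

lemma Changes.one_zero {x y : Grid n 2} (h : Changes 1 0 x y) :
    zeros y = zeros x + 1 ∧ ones y + 1 = ones x ∧ twos y = twos x := by
  have h0 := h.card_filter 0
  have h1 := h.card_filter 1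
  have h2 := h.card_filter 2
  simp at h0 h1 h2
  exact ⟨h0, h1, h2⟩

/-- The paths from `x` to `w` that first lower any coordinate by one, then lower a `2` to a `1`,
and then a `1` to a `0`. -/
noncomputable def paths (x w : Grid n 2) : Finset (Grid n 2 × Grid n 2) :=
  {p | p.1 ∈ below x 1 ∧ Changes 2 1 p.1 p.2 ∧ Changes 1 0 p.2 w}

lemma mem_paths {x w : Grid n 2} {p : Grid n 2 × Grid n 2} :
    p ∈ paths x w ↔ p.1 ∈ below x 1 ∧ Changes 2 1 p.1 p.2 ∧ Changes 1 0 p.2 w := by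
  simp [paths]

/-- The flow from rank `n + 2` to rank `n - 1`. -/
noncomputable def flow (x w : Grid n 2) : ℝ :=
  #(paths x w) / ((twos x + ones x : ℝ) * ((twos w + 1) * (ones w + 1)))

lemma flow_nonneg (x w : Grid n 2) : 0 ≤ flow x w := by
  unfold flow; positivity

/-- The second vertex is determined by the first one y, since only one coordinate is 2 in y and not
in w. The number of zeros of y is fixed by w, so all first steps from x are of the same kind (2 to
1, or 1 to 0), and each kind leaves at most two coordinates to choose from. -/
lemma card_paths_le_two {x w : Grid n 2} (hx : rank x = n + 2) : #(paths x w) ≤ 2 := by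
  have hfib : ∀ p ∈ paths x w, ∀ q ∈ paths x w, p.1 = q.1 → p.2 = q.2 := by
    rintro ⟨y, z⟩ hp ⟨y', z'⟩ hq (rfl : y = y')
    obtain ⟨-, h1, h2⟩ := mem_paths.1 hp
    obtain ⟨-, h3, h4⟩ := mem_paths.1 hq
    simp only at h1 h2 h3 h4 ⊢
    have hwz := h2.le (by decide)
    have hwz' := h4.le (by decide)
    have hzy := h1.le (by decide)
    have hcard := card_filter_two_ne_two (hwz.trans hzy)
    have e1 := h1.two_one
    have e2 := h2.one_zero
    obtain ⟨i, hi, rfl⟩ := h1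
    obtain ⟨j, hj, rfl⟩ := h3
    have hone : #{i | y i = 2 ∧ w i ≠ 2} ≤ 1 := by omega
    rw [card_le_one] at hone
    have hin : ∀ k, y k = 2 → w ≤ Function.update y k 1 → k ∈ ({i | y i = 2 ∧ w i ≠ 2} : Finset _) := by
      intro k hk hle
      simp only [mem_filter, mem_univ, true_and]
      refine ⟨hk, fun h => ?_⟩
      have := hle k
      rw [h, Function.update_self] at this
      exact absurd (Fin.le_def.1 this) (by simp)
    rw [hone i (hin i hi hwz) j (hin j hj hwz')]
  have hinj : Set.InjOn Prod.fst (paths x w : Set (Grid n 2 × Grid n 2)) := fun p hp q hq h =>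
    Prod.ext h (hfib p hp q hq h)
  rw [← card_image_of_injOn hinj]
  rcases (paths x w).eq_empty_or_nonempty with he | ⟨⟨y, z⟩, hp⟩
  · simp [he]
  have hdata : ∀ p ∈ paths x w, w ≤ p.1 ∧ zeros p.1 + 1 = zeros w ∧ twos p.1 = twos w + 1 := by
    intro p hp
    obtain ⟨-, h1, h2⟩ := mem_paths.1 hp
    have := h1.two_one
    have := h2.one_zero
    exact ⟨(h2.le (by decide)).trans (h1.le (by decide)), by omega, by omega⟩
  have hy := (mem_paths.1 hp).1
  have hwx : w ≤ x := (hdata _ hp).1.trans (mem_below.1 hy).1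
  have hrx := rank_add_zeros x
  have hry := rank_add_zeros y
  have hyx := (mem_below.1 hy).2
  have hyd := hdata _ hp
  simp only at hy hyd
  rcases mem_below_one.1 hy with hc | hc
  · have hc' := hc.two_one
    have hcard := card_filter_two_ne_two hwx
    have hle : #((paths x w).image Prod.fst) ≤ #{i | x i = 2 ∧ w i ≠ 2} := by
      refine (card_le_card fun y' hy' => ?_).trans
        (card_image_le (f := fun i => Function.update x i (1 : Fin (2 + 1))))
      obtain ⟨p, hp', rfl⟩ := mem_image.1 hy'
      have hd := hdata p hp'
      rcases mem_below_one.1 (mem_paths.1 hp').1 with h | h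
      · obtain ⟨i, hi, he⟩ := h
        refine mem_image.2 ⟨i, ?_, he.symm⟩
        simp only [mem_filter, mem_univ, true_and]
        refine ⟨hi, fun h => ?_⟩
        have := hd.1 i
        rw [h, he, Function.update_self] at this
        exact absurd (Fin.le_def.1 this) (by simp)
      · have := h.one_zero
        omega
    omega
  · have hc' := hc.one_zero
    have hcard := card_filter_zero_ne_zero hwx
    have hle : #((paths x w).image Prod.fst) ≤ #{i | w i = 0 ∧ x i ≠ 0} := by
      refine (card_le_card fun y' hy' => ?_).trans
        (card_image_le (f := fun i => Function.update x i (0 : Fin (2 + 1))))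
      obtain ⟨p, hp', rfl⟩ := mem_image.1 hy'
      have hd := hdata p hp'
      rcases mem_below_one.1 (mem_paths.1 hp').1 with h | h
      · have := h.two_one
        omega
      · obtain ⟨i, hi, he⟩ := h
        refine mem_image.2 ⟨i, ?_, he.symm⟩
        simp only [mem_filter, mem_univ, true_and]
        refine ⟨?_, by rw [hi]; decide⟩
        have := hd.1 i
        rw [he, Function.update_self] at this
        exact le_antisymm this (Fin.zero_le _)
    omega

/-- What a path between ranks `n + 2` and `n - 1` says about its ends. -/
lemma of_mem_paths {x w : Grid n 2} {p : Grid n 2 × Grid n 2} (hp : p ∈ paths x w) :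
    w < x ∧ rank w + 3 = rank x ∧ zeros x ≤ zeros p.1 ∧ zeros p.1 ≤ zeros x + 1 ∧
      zeros p.1 + 1 = zeros w := by
  obtain ⟨h0, h1, h2⟩ := mem_paths.1 hp
  have e0 := mem_below.1 h0
  have e1 := h1.two_one
  have e2 := h2.one_zero
  have r1 := h1.rank_add
  have r2 := h2.rank_add
  simp at r1 r2
  have hle : w ≤ x := (h2.le (by decide)).trans ((h1.le (by decide)).trans e0.1)
  have hz := zeros_anti e0.1
  have hr : rank w + 3 = rank x := by omega
  have hz' : zeros p.1 ≤ zeros x + 1 := by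
    rcases mem_below_one.1 h0 with h | h
    · have := h.two_one; omega
    · have := h.one_zero; omega
  exact ⟨lt_of_le_of_ne hle fun h => by subst h; omega, hr, by omega, by omega, by omega⟩

lemma card_paths_eq_sum (x w : Grid n 2) : (#(paths x w) : ℝ)
    = ∑ y ∈ below x 1, ∑ z with Changes 2 1 y z, if Changes 1 0 z w then 1 else 0 := by
  have : #(paths x w)
      = ∑ y ∈ below x 1, ∑ z with Changes 2 1 y z, if Changes 1 0 z w then 1 else 0 := by
    have e : paths x w = (univ ×ˢ univ).filter
        (fun p : Grid n 2 × Grid n 2 => p.1 ∈ below x 1 ∧ Changes 2 1 p.1 p.2 ∧ Changes 1 0 p.2 w) := by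
      simp [paths]
    rw [e, card_filter, sum_product, ← sum_filter_add_sum_filter_not univ (fun y => y ∈ below x 1)]
    rw [filter_mem_eq_inter, univ_inter, sum_eq_zero (s := univ.filter fun y => y ∉ below x 1),
      add_zero]
    · refine sum_congr rfl fun y hy => ?_
      rw [sum_filter]
      refine sum_congr rfl fun z _ => ?_
      by_cases h : Changes 2 1 y z <;> simp [hy, h]
    · intro y hy
      have hy : y ∉ below x 1 := (mem_filter.1 hy).2
      simp [hy]
  rw [this]
  push_cast
  rfl

/-- The flow is the law of a random walk from x whose three steps are uniform: one of the `twos x +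
ones x` lower covers y, one of the `twos y` changes of a 2, one of the `ones y + 1` changes of a 1.
At the end `twos y = twos w + 1` and `ones y = ones w`, so the weight of a path depends only on x
and w. -/
lemma sum_flow_eq_one {x : Grid n 2} (hx : rank x = n + 2) : ∑ w, flow x w = 1 := by
  have hN : 0 < twos x + ones x := by
    have := rank_eq_ones_add x
    omega
  have hNR : (0 : ℝ) < twos x + ones x := by exact_mod_cast hN
  have key : ∀ w, flow x w = (∑ y ∈ below x 1, ∑ z with Changes 2 1 y z,
      if Changes 1 0 z w then 1 / ((twos y : ℝ) * (ones y + 1)) else 0) / (twos x + ones x) := by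
    intro w
    rw [flow, card_paths_eq_sum, ← div_div, div_right_comm]
    congr 1
    rw [sum_div]
    refine sum_congr rfl fun y _ => ?_
    rw [sum_div]
    refine sum_congr rfl fun z hz => ?_
    have h1 := (mem_filter.1 hz).2.two_one
    split_ifs with h
    · have h2 := h.one_zero
      have e1 : (twos y : ℝ) = twos w + 1 := by exact_mod_cast (by omega : twos y = twos w + 1)
      have e2 : (ones y : ℝ) = ones w := by exact_mod_cast (by omega : ones y = ones w)
      rw [e1, e2]
    · simp
  rw [sum_congr rfl fun w _ => key w, ← sum_div, sum_comm, div_eq_one_iff_eq hNR.ne']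
  have h1 : ∀ y ∈ below x 1, ∑ w, ∑ z with Changes 2 1 y z,
      (if Changes 1 0 z w then 1 / ((twos y : ℝ) * (ones y + 1)) else 0) = 1 := by
    intro y hy
    rw [sum_comm]
    have h2 : ∀ z ∈ univ.filter (fun z => Changes 2 1 y z), ∑ w,
        (if Changes 1 0 z w then 1 / ((twos y : ℝ) * (ones y + 1)) else 0) = 1 / twos y := by
      intro z hz
      have h1 := (mem_filter.1 hz).2.two_one
      rw [← sum_filter, sum_const, card_changes (by decide), nsmul_eq_mul]
      have : (#{i | z i = 1} : ℝ) = ones y + 1 := by exact_mod_cast h1.2.1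
      rw [this, mul_one_div, div_mul_cancel_right₀ (by positivity), one_div]
    rw [sum_congr rfl h2, sum_const, card_changes (by decide), nsmul_eq_mul]
    have : 0 < twos y := by
      have := rank_add_zeros y
      have := (mem_below.1 hy).2
      omega
    have : (0 : ℝ) < twos y := by exact_mod_cast this
    exact mul_one_div_cancel this.ne'
  rw [sum_congr rfl h1, sum_const, card_below, cnt_one]
  simp

/-- Trace the walk back from w: as `zeros w = twos w + 1`, there are exactly (twos w + 1)(ones w +
1) ways to reach rank n + 1, which cancels the denominator. The remaining upward step contributes at
most one. -/
lemma sum_flow_le_one {w : Grid n 2} (hw : rank w + 1 = n) :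
    ∑ x, flow x w ≤ 1 := by
  have hA : (0 : ℝ) < (twos w + 1) * (ones w + 1) := by positivity
  have key : ∀ x, flow x w = (∑ z with Changes 1 0 z w, ∑ y with Changes 2 1 y z,
      if y ∈ below x 1 then 1 / (twos x + ones x : ℝ) else 0) / ((twos w + 1) * (ones w + 1)) := by
    intro x
    have e : below x 1 = univ.filter (fun y => y ∈ below x 1) := by ext; simp
    rw [flow, card_paths_eq_sum, ← div_div]
    congr 1
    calc _ = ∑ y, ∑ z, if y ∈ below x 1 ∧ Changes 2 1 y z ∧ Changes 1 0 z w then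
          1 / (twos x + ones x : ℝ) else 0 := by
          rw [e, sum_filter, sum_div]
          refine sum_congr rfl fun y _ => ?_
          rw [sum_filter]
          by_cases hy : y ∈ below x 1
          · simp only [hy, if_true, sum_div]
            refine sum_congr rfl fun z _ => ?_
            by_cases h1 : Changes 2 1 y z <;> by_cases h2 : Changes 1 0 z w <;> simp [hy, h1, h2]
          · simp [hy]
      _ = _ := by
          rw [sum_comm, sum_filter]
          refine sum_congr rfl fun z _ => ?_
          by_cases h2 : Changes 1 0 z w
          · simp only [h2, if_true, and_true, sum_filter]
            refine sum_congr rfl fun y _ => ?_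
            by_cases h1 : Changes 2 1 y z <;> simp [h1]
          · simp [h2]
  rw [sum_congr rfl fun x _ => key x, ← sum_div, div_le_one hA, sum_comm]
  have hz := rank_add_zeros w
  have h1 : ∀ z ∈ univ.filter (fun z => Changes 1 0 z w), ∑ x, ∑ y with Changes 2 1 y z,
      (if y ∈ below x 1 then 1 / (twos x + ones x : ℝ) else 0) ≤ ones w + 1 := by
    intro z hz'
    have h1 := (mem_filter.1 hz').2.one_zero
    rw [sum_comm]
    have h2 : ∀ y ∈ univ.filter (fun y => Changes 2 1 y z), ∑ x,
        (if y ∈ below x 1 then 1 / (twos x + ones x : ℝ) else 0) ≤ 1 := by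
      intro y hy
      have h2 := (mem_filter.1 hy).2.two_one
      -- At rank n + 1, y has fewer 0s than 2s, so an upper cover x has at least as many lower
      -- covers as y has upper covers.
      have h3 : ∀ x ∈ above y 1, 1 / (twos x + ones x : ℝ) ≤ 1 / (zeros y + ones y : ℝ) := by
        intro x hx
        have hle := zeros_anti (mem_above.1 hx).1
        have e1 := zeros_add_ones_add_twos x
        have e2 := zeros_add_ones_add_twos y
        by_cases h0 : zeros y + ones y = 0
        · have hemp : above y 1 = ∅ := by
            rw [← card_eq_zero, card_above, cnt_one, h0]
          rw [hemp] at hx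
          exact absurd hx (notMem_empty _)
        · have hc : zeros y + ones y ≤ twos x + ones x := by omega
          refine one_div_le_one_div_of_le ?_ (by exact_mod_cast hc)
          exact_mod_cast Nat.pos_of_ne_zero h0
      have e : univ.filter (fun x => y ∈ below x 1) = above y 1 := by
        ext x
        simp only [mem_filter, mem_univ, true_and, mem_above, mem_below]
        exact and_congr_right fun _ => by omega
      rw [← sum_filter, e]
      refine (sum_le_sum h3).trans ?_
      rw [sum_const, card_above, cnt_one, nsmul_eq_mul]
      push_cast
      rw [mul_one_div]
      exact div_self_le_one _
    refine (sum_le_sum h2).trans ?_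
    have e : univ.filter (fun y : Grid n 2 => Changes 2 1 y z) = univ.filter (fun y => Changes 1 2 z y) :=
      filter_congr fun y _ => changes_comm
    rw [sum_const, e, card_changes (by decide), nsmul_eq_mul, mul_one]
    have : #{i | z i = 1} = ones w + 1 := by
      change ones z = _; omega
    rw [this]; push_cast; rfl
  refine (sum_le_sum h1).trans ?_
  have e : univ.filter (fun z : Grid n 2 => Changes 1 0 z w) = univ.filter (fun z => Changes 0 1 w z) :=
    filter_congr fun y _ => changes_comm
  rw [sum_const, e, card_changes (by decide), nsmul_eq_mul]
  have : #{i | w i = 0} = twos w + 1 := by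
    change zeros w = _; omega
  rw [this]; push_cast; rfl

/-! ### Moving the outer elements to the three middle layers -/

/-- The number of elements above `w` of rank at most `n + 1`. -/
noncomputable def load (w : Grid n 2) : ℕ := #{z | w < z ∧ rank z < n + 2}

/-- The number of members of `F` below `x` of rank at least `n - 1`. -/
noncomputable def saving (F : Finset (Grid n 2)) (x : Grid n 2) : ℕ := #{z ∈ F | z < x ∧ n ≤ rank z + 1}

lemma load_eq {w : Grid n 2} (hw : rank w + 1 = n) :
    load w = (n - twos w + 1).choose 2 + twos w + 1 := by
  have h1 := rank_add_zeros w
  have h2 := zeros_add_ones_add_twos w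
  rw [load, card_filter_rank_Ioo_above, show n + 2 - rank w = 3 by omega,
    show Ioo 0 3 = ({1, 2} : Finset ℕ) by decide, sum_pair (by decide), card_above, card_above,
    cnt_one, cnt_two, show zeros w + ones w = n - twos w by omega,
    Nat.choose_succ_succ' _ 1, Nat.choose_one_right, one_add_one_eq_two]
  omega

lemma UpperClosed.card_below_three_le_saving {F : Finset (Grid n 2)} (hF : UpperClosed F)
    {x : Grid n 2} (hx : x ∈ F) (hr : n + 3 ≤ rank x) : #(below x 3) ≤ saving F x := by
  refine card_le_card fun z hz => ?_
  obtain ⟨h1, h2⟩ := mem_below.1 hz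
  have hlt : z < x := lt_of_le_of_ne h1 fun h => by subst h; omega
  exact mem_filter.2 ⟨hF x hx z hlt (by omega), hlt, by omega⟩

/-- Here θ is a price for one element: the shortfall of an outer member's saving is sent along the
flow to missing elements whose load lies below the price. `h3` makes members of rank at least n + 3
harmless. `h2` says that flow times shortfall is at most one, so that the part arriving at a member
w of F is paid by w itself, which is counted in the saving. -/
lemma UpperClosed.sum_sub_saving_le {F : Finset (Grid n 2)} (hF : UpperClosed F) (hn : 1 ≤ n) {θ : ℝ}
    (h3 : θ ≤ ((n + 3) / 2).choose 3)
    (h2 : ∀ k, 2 * k + 1 ≤ n →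
      2 * (θ - (((n - k + 1).choose 2 : ℕ) + k + 1)) ≤ (n - k) * ((k + 1) * (n - 2 * k))) :
    ∑ x ∈ F with n + 2 ≤ rank x, (θ - saving F x)
      ≤ ∑ w with rank w + 1 = n ∧ w ∉ F, max 0 (θ - load w) := by
  have hx3 : ∀ x ∈ F, n + 3 ≤ rank x → θ - saving F x ≤ 0 := by
    intro x hx hr
    have e1 := rank_add_zeros x
    have e2 := zeros_add_ones_add_twos x
    have h := hF.card_below_three_le_saving hx hr
    have h' : ((n + 3) / 2).choose 3 ≤ saving F x :=
      (Nat.choose_le_choose 3 (by omega)).trans ((choose_le_cnt _ _ _).trans ((card_below x 3).ge.trans h))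
    have h'' : (((n + 3) / 2).choose 3 : ℝ) ≤ saving F x := by exact_mod_cast h'
    linarith
  have hflow : ∀ x ∈ F, rank x = n + 2 → θ - saving F x
      ≤ ∑ w with rank w + 1 = n ∧ w ∉ F, flow x w * max 0 (θ - load w) := by
    intro x hx hr
    have ex1 := rank_add_zeros x
    have ex2 := zeros_add_ones_add_twos x
    have hsplit : #{z | z < x ∧ n - 1 < rank z} + #{w ∈ F | w < x ∧ rank w + 1 = n} ≤ saving F x := by
      rw [saving, ← card_union_of_disjoint]
      · refine card_le_card fun z hz => ?_
        simp only [mem_union, mem_filter, mem_univ, true_and] at hz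
        rcases hz with hz | hz
        · exact mem_filter.2 ⟨hF x hx z hz.1 (by omega), hz.1, by omega⟩
        · exact mem_filter.2 ⟨hz.1, hz.2.1, by omega⟩
      · refine disjoint_left.2 fun z hz hz' => ?_
        simp only [mem_filter, mem_univ, true_and] at hz hz'
        omega
    have hsupp : ∀ w, flow x w ≠ 0 → w < x ∧ rank w + 1 = n ∧ zeros x ≤ twos w ∧ twos w ≤ zeros x + 1 := by
      intro w hw
      have hne : (paths x w).Nonempty := by
        rw [nonempty_iff_ne_empty]
        intro he
        exact hw (by simp [flow, he])
      obtain ⟨p, hp⟩ := hne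
      obtain ⟨h1, h4, h5, h6, h7⟩ := of_mem_paths hp
      have := rank_add_zeros w
      exact ⟨h1, by omega, by omega, by omega⟩
    have hload : ∀ w, flow x w ≠ 0 → load w ≤ #{z | z < x ∧ n - 1 < rank z} := by
      intro w hw
      obtain ⟨h1, h4, h5, h6⟩ := hsupp w hw
      have e1 := rank_add_zeros w
      have e2 := zeros_add_ones_add_twos w
      rw [load, card_filter_rank_Ioo_above, card_filter_rank_Ioo_below,
        show n + 2 - rank w = 3 by omega, show rank x - (n - 1) = 3 by omega]
      refine sum_le_sum fun j _ => ?_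
      rw [card_above, card_below]
      exact cnt_le_cnt (by omega) (by omega) j
    -- The factor 2 in `h2` bounds the number of paths; the right side of `h2`, at k = `twos w`,
    -- bounds the denominator of the flow from below.
    have hpay : ∀ w, flow x w * max 0 (θ - load w) ≤ 1 := by
      intro w
      by_cases hw : flow x w = 0
      · simp [hw]
      obtain ⟨h1, h4, h5, h6⟩ := hsupp w hw
      have e1 := rank_add_zeros w
      have e2 := zeros_add_ones_add_twos w
      have hk := h2 (twos w) (by omega)
      have hl : (load w : ℝ) = ((n - twos w + 1).choose 2 : ℕ) + twos w + 1 := by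
        rw [load_eq h4]; push_cast; ring
      rw [← hl] at hk
      have hden : (0 : ℝ) < (twos x + ones x : ℝ) * ((twos w + 1) * (ones w + 1)) := by
        have : (0 : ℝ) < twos x + ones x := by exact_mod_cast (by omega : 0 < twos x + ones x)
        positivity
      have hones : (ones w : ℝ) + 1 = n - 2 * twos w := by
        have : ones w + 1 + 2 * twos w = n := by omega
        have : (ones w + 1 + 2 * twos w : ℝ) = n := by exact_mod_cast this
        linarith
      have hN : (n : ℝ) - twos w ≤ twos x + ones x := by
        have : n ≤ twos x + ones x + twos w := by omega
        have : (n : ℝ) ≤ twos x + ones x + twos w := by exact_mod_cast this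
        linarith
      have hp : (#(paths x w) : ℝ) ≤ 2 := by exact_mod_cast card_paths_le_two hr
      rw [flow, div_mul_eq_mul_div, div_le_one hden]
      calc (#(paths x w) : ℝ) * max 0 (θ - load w) ≤ 2 * max 0 (θ - load w) := by gcongr
        _ ≤ _ := by
          rw [mul_max_of_nonneg _ _ (by norm_num)]
          refine max_le (by simpa using hden.le) (hk.trans ?_)
          rw [hones]
          have : (0 : ℝ) ≤ (twos w + 1) * (n - 2 * twos w) := by rw [← hones]; positivity
          gcongr
    -- The shortfall at x is averaged over the flow of total mass one, and the load of every reached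
    -- w is at most the down-count of x.
    have hall : θ - #{z | z < x ∧ n - 1 < rank z} ≤ ∑ w, flow x w * max 0 (θ - load w) := by
      calc θ - #{z | z < x ∧ n - 1 < rank z}
          = ∑ w, flow x w * (θ - #{z | z < x ∧ n - 1 < rank z}) := by
            rw [← sum_mul, sum_flow_eq_one hr, one_mul]
        _ ≤ _ := by
          refine sum_le_sum fun w _ => ?_
          by_cases hw : flow x w = 0
          · simp [hw]
          · refine mul_le_mul_of_nonneg_left ?_ (flow_nonneg x w)
            have : (load w : ℝ) ≤ #{z | z < x ∧ n - 1 < rank z} := by exact_mod_cast hload w hw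
            exact le_max_of_le_right (by linarith)
    have hcut : ∑ w, flow x w * max 0 (θ - load w)
        ≤ ∑ w with rank w + 1 = n ∧ w ∉ F, flow x w * max 0 (θ - load w)
          + #{w ∈ F | w < x ∧ rank w + 1 = n} := by
      rw [← sum_filter_add_sum_filter_not univ (fun w => rank w + 1 = n ∧ w ∉ F)]
      gcongr
      rw [card_eq_sum_ones]
      push_cast
      rw [← sum_filter_of_ne (p := fun w => flow x w ≠ 0) (by
        intro w _ hne h0
        exact hne (by simp [h0]))]
      refine (sum_le_sum fun w _ => hpay w).trans (sum_le_sum_of_subset_of_nonneg ?_ (by simp))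
      intro w hw
      simp only [mem_filter, mem_univ, true_and] at hw ⊢
      obtain ⟨h1, h4, -⟩ := hsupp w hw.2
      have : w ∈ F := by
        by_contra h
        exact hw.1 ⟨h4, h⟩
      exact ⟨this, h1, h4⟩
    have hs : (#{z | z < x ∧ n - 1 < rank z} : ℝ) + #{w ∈ F | w < x ∧ rank w + 1 = n} ≤ saving F x := by
      exact_mod_cast hsplit
    linarith
  calc ∑ x ∈ F with n + 2 ≤ rank x, (θ - saving F x)
      ≤ ∑ x ∈ F with n + 2 ≤ rank x,
          ∑ w with rank w + 1 = n ∧ w ∉ F, flow x w * max 0 (θ - load w) := by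
        refine sum_le_sum fun x hx => ?_
        obtain ⟨hxF, hr⟩ := mem_filter.1 hx
        rcases hr.eq_or_lt with h | h
        · exact hflow x hxF h.symm
        · exact (hx3 x hxF h).trans (sum_nonneg fun w _ =>
            mul_nonneg (flow_nonneg x w) (le_max_left _ _))
    _ ≤ ∑ x, ∑ w with rank w + 1 = n ∧ w ∉ F, flow x w * max 0 (θ - load w) :=
        sum_le_sum_of_subset_of_nonneg (subset_univ _) fun x _ _ => sum_nonneg fun w _ =>
            mul_nonneg (flow_nonneg x w) (le_max_left _ _)
    _ = ∑ w with rank w + 1 = n ∧ w ∉ F, (∑ x, flow x w) * max 0 (θ - load w) := by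
        rw [sum_comm]
        exact sum_congr rfl fun w _ => (sum_mul _ _ _).symm
    _ ≤ _ := by
        refine sum_le_sum fun w hw => ?_
        have := sum_flow_le_one (mem_filter.1 hw).2.1
        exact mul_le_of_le_one_left (le_max_left _ _) this

/-! ### The exchange of outer members for missing elements of least load -/

lemma exists_subset_smallest {α : Type*} (s : Finset α) (D : α → ℕ) {m : ℕ} (hm : m ≤ #s) :
    ∃ Q ⊆ s, #Q = m ∧ ∃ θ, (∀ q ∈ Q, D q ≤ θ) ∧ (∀ w ∈ s, w ∉ Q → θ ≤ D w) ∧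
      (θ = 0 ∨ ∃ w ∈ s, θ = D w) := by
  induction m with
  | zero => exact ⟨∅, empty_subset _, rfl, 0, by simp, by simp, Or.inl rfl⟩
  | succ m ih =>
    obtain ⟨Q, hQ, hc, θ, h1, h2, -⟩ := ih (by omega)
    have hne : (s \ Q).Nonempty := by
      rw [← card_pos, card_sdiff_of_subset hQ]
      omega
    obtain ⟨q, hq, hmin⟩ := exists_min_image (s \ Q) D hne
    obtain ⟨hqs, hqQ⟩ := mem_sdiff.1 hq
    refine ⟨insert q Q, insert_subset hqs hQ, by rw [card_insert_of_notMem hqQ, hc], D q, ?_, ?_,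
      Or.inr ⟨q, hqs, rfl⟩⟩
    · intro z hz
      rcases mem_insert.1 hz with rfl | hz
      · exact le_rfl
      · exact (h1 z hz).trans (h2 q hqs hqQ)
    · intro w hw hwQ
      exact hmin w (mem_sdiff.2 ⟨hw, fun h => hwQ (mem_insert_of_mem h)⟩)

lemma comp_eq_sum_card_above (F : Finset (Grid n 2)) : comp F = ∑ x ∈ F, #{z ∈ F | x < z} := by
  simp only [comp_eq_sum, card_filter]

lemma comp_eq_sum_card_below (F : Finset (Grid n 2)) : comp F = ∑ x ∈ F, #{z ∈ F | z < x} := by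
  rw [comp_eq_sum, sum_comm]
  simp only [card_filter]

lemma card_filter_image_reversal (F : Finset (Grid n 2)) (p : Grid n 2 → Prop)
    [DecidablePred p] : #{z ∈ F.image reversal | p z} = #{z ∈ F | p (reversal z)} := by
  rw [filter_image, card_image_reversal]

lemma load_reversal (w : Grid n 2) : load (reversal w) = #{z | z < w ∧ n ≤ rank z + 1} := by
  have e : (univ : Finset (Grid n 2)) = univ.image reversal := by
    ext z; simp only [mem_univ, true_iff]; exact mem_image.2 ⟨reversal z, mem_univ _, by simp⟩
  rw [load]
  conv_lhs => rw [e]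
  rw [card_filter_image_reversal]
  refine congrArg card ?_
  refine filter_congr fun z _ => ?_
  have := rank_reversal z
  rw [reversal_lt_reversal]
  exact and_congr_right fun _ => by omega

lemma saving_reversal (F : Finset (Grid n 2)) (x : Grid n 2) :
    saving (F.image reversal) (reversal x) = #{z ∈ F | x < z ∧ rank z ≤ n + 1} := by
  rw [saving, card_filter_image_reversal]
  refine congrArg card (filter_congr fun z _ => ?_)
  have := rank_reversal z
  rw [reversal_lt_reversal]
  exact and_congr_right fun _ => by omega

/-- A tight family lies in the three middle layers when enough elements of low load are missing
from it. -/
lemma IsTight.rank_mem {F : Finset (Grid n 2)} (hF : IsTight F) (hn : 1 ≤ n) {θ₀ : ℕ}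
    (h3 : θ₀ ≤ ((n + 3) / 2).choose 3)
    (h2 : ∀ k : ℕ, 2 * k + 1 ≤ n →
      2 * ((θ₀ : ℝ) - (((n - k + 1).choose 2 : ℕ) + k + 1)) ≤ (n - k) * ((k + 1) * (n - 2 * k)))
    (hlow : #{x ∈ F | n + 2 ≤ rank x} + #{x ∈ F | rank x + 2 ≤ n}
      ≤ #{w | rank w + 1 = n ∧ w ∉ F ∧ load w ≤ θ₀}
        + #{w | rank w = n + 1 ∧ w ∉ F ∧ load (reversal w) ≤ θ₀}) :
    ∀ x ∈ F, n ≤ rank x + 1 ∧ rank x ≤ n + 1 := by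
  set Op := F.filter fun x => n + 2 ≤ rank x with hOp
  set Om := F.filter fun x => rank x + 2 ≤ n with hOm
  set D : Grid n 2 → ℕ := fun w => if rank w + 1 = n then load w else load (reversal w) with hD
  set Wm := (univ : Finset (Grid n 2)).filter fun w => rank w + 1 = n ∧ w ∉ F with hWm
  set Wp := (univ : Finset (Grid n 2)).filter fun w => rank w = n + 1 ∧ w ∉ F with hWp
  have hOdisj : Disjoint Op Om := disjoint_left.2 fun x hx hx' => by
    have := (mem_filter.1 hx).2
    have := (mem_filter.1 hx').2
    omega
  have hWdisj : Disjoint Wm Wp := disjoint_left.2 fun x hx hx' => by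
    have := (mem_filter.1 hx).2.1
    have := (mem_filter.1 hx').2.1
    omega
  have hcard : #(Op ∪ Om) ≤ #((Wm ∪ Wp).filter fun w => D w ≤ θ₀) := by
    rw [card_union_of_disjoint hOdisj]
    refine hlow.trans ?_
    rw [← card_union_of_disjoint]
    · refine card_le_card fun w hw => ?_
      simp only [mem_union, mem_filter, mem_univ, true_and, hWm, hWp, hD] at hw ⊢
      rcases hw with hw | hw
      · exact ⟨Or.inl ⟨hw.1, hw.2.1⟩, by rw [if_pos hw.1]; exact hw.2.2⟩
      · exact ⟨Or.inr ⟨hw.1, hw.2.1⟩, by rw [if_neg (by omega)]; exact hw.2.2⟩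
    · refine disjoint_left.2 fun w hw hw' => ?_
      simp only [mem_filter, mem_univ, true_and] at hw hw'
      omega
  -- Q consists of as many missing elements as there are outer members, chosen by smallest load, and
  -- θ is the cut-off. Being 0 or an attained load, θ is at most θ₀.
  obtain ⟨Q, hQs, hQc, θ, hθ1, hθ2, hθ3⟩ := exists_subset_smallest _ D hcard
  have hθ₀ : θ ≤ θ₀ := by
    rcases hθ3 with rfl | ⟨w, hw, rfl⟩
    · exact Nat.zero_le _
    · exact (mem_filter.1 hw).2
  have hQW : Q ⊆ Wm ∪ Wp := hQs.trans (filter_subset _ _)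
  have hup := hF.upperClosed
  have hdown := hF.image_reversal.upperClosed
  -- comparison of savings and loads
  have hθr : (θ : ℝ) ≤ θ₀ := by exact_mod_cast hθ₀
  have h3' : (θ : ℝ) ≤ ((n + 3) / 2).choose 3 := by exact_mod_cast hθ₀.trans h3
  have h2' : ∀ k : ℕ, 2 * k + 1 ≤ n →
      2 * ((θ : ℝ) - (((n - k + 1).choose 2 : ℕ) + k + 1)) ≤ (n - k) * ((k + 1) * (n - 2 * k)) :=
    fun k hk => le_trans (by linarith) (h2 k hk)
  have hplus : ∑ x ∈ Op, ((θ : ℝ) - saving F x) ≤ ∑ w ∈ Wm, max 0 ((θ : ℝ) - D w) := by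
    refine (hup.sum_sub_saving_le hn h3' h2').trans (le_of_eq (sum_congr rfl fun w hw => ?_))
    rw [hD]; simp only; rw [if_pos (mem_filter.1 hw).2.1]
  have hminus : ∑ x ∈ Om, ((θ : ℝ) - #{z ∈ F | x < z ∧ rank z ≤ n + 1})
      ≤ ∑ w ∈ Wp, max 0 ((θ : ℝ) - D w) := by
    have h := hdown.sum_sub_saving_le hn h3' h2'
    have e1 : (F.image reversal).filter (fun x => n + 2 ≤ rank x) = Om.image reversal := by
      ext x
      have := rank_reversal x
      simp only [mem_filter, mem_image_reversal, hOm]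
      exact and_congr_right fun _ => by omega
    have e2 : (univ : Finset (Grid n 2)).filter (fun w => rank w + 1 = n ∧ w ∉ F.image reversal)
        = Wp.image reversal := by
      ext x
      have := rank_reversal x
      simp only [mem_filter, mem_image_reversal, hWp, mem_univ, true_and]
      exact and_congr_left fun _ => by omega
    rw [e1, e2, sum_image reversal_injective.injOn, sum_image reversal_injective.injOn] at h
    simp only [saving_reversal] at h
    refine h.trans (le_of_eq (sum_congr rfl fun w hw => ?_))
    have := (mem_filter.1 hw).2.1
    rw [hD]; simp only; rw [if_neg (by omega)]
  -- Since θ separates Q from the rest, the positive parts live on Q. As Q and the outer members are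
  -- equinumerous, θ then cancels in `hDsum`.
  have hQsum : ∑ w ∈ Wm ∪ Wp, max 0 ((θ : ℝ) - D w) = ∑ w ∈ Q, ((θ : ℝ) - D w) := by
    rw [← sum_sdiff hQW, sum_eq_zero, zero_add]
    · refine sum_congr rfl fun w hw => max_eq_right ?_
      have : (D w : ℝ) ≤ θ := by exact_mod_cast hθ1 w hw
      linarith
    · intro w hw
      obtain ⟨hw1, hw2⟩ := mem_sdiff.1 hw
      have hle : θ ≤ D w := by
        by_cases h : D w ≤ θ₀
        · exact hθ2 w (mem_filter.2 ⟨hw1, h⟩) hw2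
        · omega
      have : (θ : ℝ) ≤ D w := by exact_mod_cast hle
      exact max_eq_left (by linarith)
  have hDsum : ∑ w ∈ Q, D w ≤ ∑ x ∈ Op, saving F x + ∑ x ∈ Om, #{z ∈ F | x < z ∧ rank z ≤ n + 1} := by
    have h := add_le_add hplus hminus
    rw [← sum_union hWdisj, hQsum, sum_sub_distrib, sum_sub_distrib, sum_sub_distrib, sum_const,
      sum_const, sum_const, hQc, card_union_of_disjoint hOdisj] at h
    simp only [nsmul_eq_mul] at h
    push_cast at h
    have : (∑ w ∈ Q, (D w : ℝ)) ≤ ∑ x ∈ Op, (saving F x : ℝ)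
        + ∑ x ∈ Om, (#{z ∈ F | x < z ∧ rank z ≤ n + 1} : ℝ) := by linarith
    exact_mod_cast this
  -- the modified family
  let G := F.filter fun x => n ≤ rank x + 1 ∧ rank x ≤ n + 1
  have hGF : ∀ x ∈ G, x ∈ F ∧ n ≤ rank x + 1 ∧ rank x ≤ n + 1 := fun x hx => mem_filter.1 hx
  have hGO : Disjoint G (Op ∪ Om) := disjoint_left.2 fun x hx hx' => by
    have := (hGF x hx).2
    rcases mem_union.1 hx' with h | h
    · have := (mem_filter.1 h).2; omega
    · have := (mem_filter.1 h).2; omega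
  have hQdata : ∀ w ∈ Q, (rank w + 1 = n ∨ rank w = n + 1) ∧ w ∉ F := by
    intro w hw
    rcases mem_union.1 (hQW hw) with h | h
    · exact ⟨Or.inl (mem_filter.1 h).2.1, (mem_filter.1 h).2.2⟩
    · exact ⟨Or.inr (mem_filter.1 h).2.1, (mem_filter.1 h).2.2⟩
  have hGQ : Disjoint G Q := disjoint_left.2 fun x hx hx' => (hQdata x hx').2 (hGF x hx).1
  have hFeq : F = G ∪ (Op ∪ Om) := by
    ext x
    simp only [G, hOp, hOm, mem_union, mem_filter, ← and_or_left]
    refine ⟨fun h => ⟨h, by omega⟩, fun h => h.1⟩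
  have hcompF : comp G + (∑ x ∈ Op, saving F x + ∑ x ∈ Om, #{z ∈ F | x < z ∧ rank z ≤ n + 1})
      ≤ comp F := by
    have hpp : ∑ x ∈ Op, saving F x ≤ ∑ x ∈ Op, deg G x + comp Op := by
      rw [comp_eq_sum_card_below, ← sum_add_distrib]
      refine sum_le_sum fun x hx => ?_
      refine (card_le_card fun z hz => ?_).trans (card_union_le _ _)
      simp only [mem_filter, mem_union, G, hOp] at hz ⊢
      have := rank_strictMono hz.2.1
      by_cases h : rank z ≤ n + 1
      · exact Or.inl ⟨⟨hz.1, hz.2.2, h⟩, Or.inl hz.2.1⟩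
      · exact Or.inr ⟨⟨hz.1, by omega⟩, hz.2.1⟩
    have hmm : ∑ x ∈ Om, #{z ∈ F | x < z ∧ rank z ≤ n + 1} ≤ ∑ x ∈ Om, deg G x + comp Om := by
      rw [comp_eq_sum_card_above, ← sum_add_distrib]
      refine sum_le_sum fun x hx => ?_
      refine (card_le_card fun z hz => ?_).trans (card_union_le _ _)
      simp only [mem_filter, mem_union, G, hOm] at hz ⊢
      by_cases h : n ≤ rank z + 1
      · exact Or.inl ⟨⟨hz.1, h, hz.2.2⟩, Or.inr hz.2.1⟩
      · exact Or.inr ⟨⟨hz.1, by omega⟩, hz.2.1⟩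
    conv_rhs => rw [hFeq]
    rw [comp_union hGO, comp_union hOdisj, sum_union hOdisj]
    omega
  -- Both G and Q lie in the three middle layers. Pairs inside Q are counted at their lower end, so
  -- `D w` bounds the contribution of each w.
  have hcompQ : comp (G ∪ Q) ≤ comp G + ∑ w ∈ Q, D w := by
    rw [comp_union hGQ, comp_eq_sum_card_above Q, add_assoc, ← sum_add_distrib]
    gcongr with w hw
    rw [deg, ← card_union_of_disjoint]
    · rcases (hQdata w hw).1 with h | h
      · rw [hD]; simp only [if_pos h, load]
        refine card_le_card fun z hz => ?_
        simp only [mem_union, mem_filter, mem_univ, true_and] at hz ⊢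
        rcases hz with ⟨hz, hz' | hz'⟩ | ⟨hz, hz'⟩
        · have := rank_strictMono hz'
          have := (hGF z hz).2
          omega
        · exact ⟨hz', by have := (hGF z hz).2; omega⟩
        · exact ⟨hz', by have := (hQdata z hz).1; omega⟩
      · rw [hD]; simp only [if_neg (show ¬ rank w + 1 = n by omega), load_reversal]
        refine card_le_card fun z hz => ?_
        simp only [mem_union, mem_filter, mem_univ, true_and] at hz ⊢
        rcases hz with ⟨hz, hz' | hz'⟩ | ⟨hz, hz'⟩
        · exact ⟨hz', (hGF z hz).2.1⟩
        · have := rank_strictMono hz'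
          have := (hGF z hz).2
          omega
        · have := rank_strictMono hz'
          have := (hQdata z hz).1
          omega
    · refine disjoint_left.2 fun z hz hz' => ?_
      exact (hQdata z (mem_filter.1 hz').1).2 (hGF z (mem_filter.1 hz).1).1
  have hspread := hF (G ∪ Q) (by
    conv_rhs => rw [hFeq]
    rw [card_union_of_disjoint hGQ, card_union_of_disjoint hGO, hQc]) (by omega)
  -- Each outer member is at distance at least 2 from the middle and each element of Q at distance
  -- 1, so tightness leaves no outer members.
  have hempty : #(Op ∪ Om) = 0 := by
    conv_lhs at hspread => rw [hFeq]
    rw [spread, spread, sum_union hGQ, sum_union hGO] at hspread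
    have e1 : ∑ x ∈ Q, ((rank x - n) + (n - rank x)) = #Q * 1 :=
      sum_const_nat fun x hx => by have := (hQdata x hx).1; omega
    have e2 : #(Op ∪ Om) * 2 ≤ ∑ x ∈ Op ∪ Om, ((rank x - n) + (n - rank x)) := by
      rw [← smul_eq_mul]
      refine card_nsmul_le_sum _ _ _ fun x hx => ?_
      rcases mem_union.1 hx with h | h
      · have := (mem_filter.1 h).2; omega
      · have := (mem_filter.1 h).2; omega
    omega
  intro x hx
  rw [card_eq_zero] at hempty
  by_contra hcon
  have : x ∈ Op ∪ Om := by
    simp only [hOp, hOm, mem_union, mem_filter]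
    by_cases h : n + 2 ≤ rank x
    · exact Or.inl ⟨hx, h⟩
    · exact Or.inr ⟨hx, by omega⟩
  rw [hempty] at this
  exact notMem_empty _ this

/-! ### Few elements have high load -/

/-- The elements of rank `n - 1` with fewer than `m` twos. -/
noncomputable def fewTwos (n m : ℕ) : Finset (Grid n 2) := {w | rank w + 1 = n ∧ twos w < m}

/-- Two double counts through rank n: a 1 is raised to 2, and then a 1 is lowered to 0. Each step
has at least n - 2m choices, while backwards there are at most m and m + 1. -/
lemma card_fewTwos_mul_le (m : ℕ) :
    #(fewTwos n m) * ((n - 2 * m) * (n - 2 * m)) ≤ #(fewTwos n (m + 1)) * (m * (m + 1)) := by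
  let B : Finset (Grid n 2) := univ.filter fun z => rank z = n ∧ twos z < m + 1
  have h1 : #(fewTwos n m) * (n - 2 * m) ≤ #B * m := by
    refine card_mul_le_card_mul (fun w z => Changes 1 2 w z) (fun w hw => ?_) (fun z hz => ?_)
    · simp only [fewTwos, mem_filter, mem_univ, true_and] at hw
      have e1 := rank_add_zeros w
      have e2 := zeros_add_ones_add_twos w
      have e : bipartiteAbove (fun w z => Changes 1 2 w z) B w = univ.filter fun z => Changes 1 2 w z := by
        ext z
        simp only [bipartiteAbove, B, mem_filter, mem_univ, true_and, and_iff_right_iff_imp]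
        intro h
        have h4 := h.symm.two_one
        have h5 := h.rank_add
        simp at h5
        omega
      rw [e, card_changes (by decide)]
      change _ ≤ ones w
      omega
    · simp only [B, mem_filter, mem_univ, true_and] at hz
      have e : bipartiteBelow (fun w z => Changes 1 2 w z) (fewTwos n m) z
          ⊆ univ.filter fun w => Changes 2 1 z w := by
        intro w hw
        exact mem_filter.2 ⟨mem_univ _, (mem_filter.1 hw).2.symm⟩
      refine (card_le_card e).trans ?_
      rw [card_changes (by decide)]
      change twos z ≤ m
      omega
  have h2 : #B * (n - 2 * m) ≤ #(fewTwos n (m + 1)) * (m + 1) := by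
    refine card_mul_le_card_mul (fun z w => Changes 1 0 z w) (fun z hz => ?_) (fun w hw => ?_)
    · simp only [B, mem_filter, mem_univ, true_and] at hz
      have e1 := rank_add_zeros z
      have e2 := zeros_add_ones_add_twos z
      have e : bipartiteAbove (fun z w => Changes 1 0 z w) (fewTwos n (m + 1)) z
          = univ.filter fun w => Changes 1 0 z w := by
        ext w
        simp only [bipartiteAbove, fewTwos, mem_filter, mem_univ, true_and, and_iff_right_iff_imp]
        intro h
        have h4 := h.one_zero
        have h5 := h.rank_add
        simp at h5
        omega
      rw [e, card_changes (by decide)]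
      change _ ≤ ones z
      omega
    · simp only [fewTwos, mem_filter, mem_univ, true_and] at hw
      have e1 := rank_add_zeros w
      have e : bipartiteBelow (fun z w => Changes 1 0 z w) B w
          ⊆ univ.filter fun z => Changes 0 1 w z := by
        intro z hz
        exact mem_filter.2 ⟨mem_univ _, (mem_filter.1 hz).2.symm⟩
      refine (card_le_card e).trans ?_
      rw [card_changes (by decide)]
      change zeros w ≤ m + 1
      omega
  calc #(fewTwos n m) * ((n - 2 * m) * (n - 2 * m)) = (#(fewTwos n m) * (n - 2 * m)) * (n - 2 * m) := by ring
    _ ≤ (#B * m) * (n - 2 * m) := by gcongr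
    _ = (#B * (n - 2 * m)) * m := by ring
    _ ≤ (#(fewTwos n (m + 1)) * (m + 1)) * m := by gcongr
    _ = _ := by ring

lemma card_fewTwos_le_mul {m : ℕ} (hm : 40 * m ≤ 13 * n) (hn : 1000 ≤ n) :
    11 * #(fewTwos n m) ≤ 10 * #(fewTwos n (m + 1)) := by
  rcases Nat.eq_zero_or_pos m with rfl | hpos
  · simp [fewTwos]
  have h := card_fewTwos_mul_le (n := n) m
  obtain ⟨d, hd⟩ : ∃ d, n = 2 * m + d := ⟨n - 2 * m, by omega⟩
  have hd' : n - 2 * m = d := by omega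
  rw [hd'] at h
  -- For m ≤ 13n/40 the ratio d/m is at least 14/13, and (14/13)² exceeds 11/10 with room for the
  -- lower-order term.
  have h1 : 11 * (m * (m + 1)) ≤ 10 * (d * d) := by
    have : 14 * m ≤ 13 * d := by omega
    have h3 : 14 * m * (14 * m) ≤ 13 * d * (13 * d) := Nat.mul_le_mul this this
    have hd3 : 300 ≤ d := by omega
    have h4 : 300 * m ≤ d * m := Nat.mul_le_mul_right _ hd3
    nlinarith
  have hp : 0 < m * (m + 1) := by positivity
  refine le_of_mul_le_mul_left ?_ hp
  calc m * (m + 1) * (11 * #(fewTwos n m)) = 11 * (m * (m + 1)) * #(fewTwos n m) := by ring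
    _ ≤ 10 * (d * d) * #(fewTwos n m) := by gcongr
    _ = 10 * (#(fewTwos n m) * (d * d)) := by ring
    _ ≤ 10 * (#(fewTwos n (m + 1)) * (m * (m + 1))) := by gcongr
    _ = _ := by ring

lemma card_fewTwos_le_pow {m : ℕ} (J : ℕ) (hm : 40 * (m + J) ≤ 13 * n) (hn : 1000 ≤ n) :
    (#(fewTwos n m) : ℝ) ≤ (10 / 11) ^ J * #{w : Grid n 2 | rank w + 1 = n} := by
  have h : ∀ J, 40 * (m + J) ≤ 13 * n →
      (#(fewTwos n m) : ℝ) ≤ (10 / 11) ^ J * #(fewTwos n (m + J)) := by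
    intro J
    induction J with
    | zero => intro _; simp
    | succ J ih =>
      intro hJ
      have h1 := card_fewTwos_le_mul (n := n) (m := m + J) (by omega) hn
      have h2 : (11 : ℝ) * #(fewTwos n (m + J)) ≤ 10 * #(fewTwos n (m + J + 1)) := by exact_mod_cast h1
      calc (#(fewTwos n m) : ℝ) ≤ (10 / 11) ^ J * #(fewTwos n (m + J)) := ih (by omega)
        _ ≤ (10 / 11) ^ J * (10 / 11 * #(fewTwos n (m + J + 1))) := by gcongr; linarith
        _ = _ := by rw [pow_succ, mul_assoc, add_assoc]
  refine (h J hm).trans ?_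
  gcongr
  intro w hw
  simp only [fewTwos, mem_filter, mem_univ, true_and] at hw ⊢
  exact hw.1

/-- In view of `load_eq`: at rank n - 1, more 2s mean a smaller load. -/
lemma loadBound_anti {j k : ℕ} (hjk : j ≤ k) (hk : k ≤ n) :
    (n - k + 1).choose 2 + k + 1 ≤ (n - j + 1).choose 2 + j + 1 := by
  induction k, hjk using Nat.le_induction with
  | base => exact le_rfl
  | succ k hjk ih =>
    refine le_trans ?_ (ih (by omega))
    obtain ⟨d, hd⟩ : ∃ d, n = k + 1 + d := ⟨n - (k + 1), by omega⟩
    rw [show n - k + 1 = (d + 1) + 1 by omega, show n - (k + 1) + 1 = d + 1 by omega,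
      Nat.choose_succ_succ' (d + 1) 1, Nat.choose_one_right, one_add_one_eq_two]
    omega

/-! ### The threshold load, taken at 8n/25 coordinates equal to 2 -/

lemma loadBound_le_choose_three (hn : 1000 ≤ n) :
    (n - 8 * n / 25 + 1).choose 2 + 8 * n / 25 + 1 ≤ ((n + 3) / 2).choose 3 := by
  refine (loadBound_anti (Nat.zero_le _) (by omega)).trans ?_
  have h := Nat.pow_sub_le_descFactorial ((n + 3) / 2) 3
  rw [Nat.descFactorial_eq_factorial_mul_choose] at h
  have h1 : 499 ≤ (n + 3) / 2 + 1 - 3 := by omega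
  have h2 : n ≤ 2 * ((n + 3) / 2 + 1 - 3) + 2 := by omega
  have h3 : (n - 0 + 1).choose 2 + 0 + 1 ≤ (n + 1) * (n + 1) := by
    rw [Nat.choose_two_right]
    have : (n - 0 + 1) * (n - 0 + 1 - 1) / 2 ≤ (n + 1) * n := Nat.div_le_self _ _
    nlinarith
  refine h3.trans ?_
  generalize (n + 3) / 2 + 1 - 3 = m at h h1 h2
  have h4 : (n + 1) * (n + 1) ≤ (2 * m + 3) * (2 * m + 3) := Nat.mul_le_mul (by omega) (by omega)
  have h5 : (2 * m + 3) * (2 * m + 3) * 6 ≤ m ^ 3 := by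
    have : 499 * (m * m) ≤ m * (m * m) := Nat.mul_le_mul_right _ h1
    nlinarith
  have h6 : Nat.factorial 3 = 6 := rfl
  rw [h6] at h
  omega

lemma two_mul_sub_loadBound_le (hn : 1000 ≤ n) {k : ℕ} (hk : 2 * k + 1 ≤ n) :
    2 * ((((n - 8 * n / 25 + 1).choose 2 + 8 * n / 25 + 1 : ℕ) : ℝ)
      - (((n - k + 1).choose 2 : ℕ) + k + 1)) ≤ (n - k) * ((k + 1) * (n - 2 * k)) := by
  have hkn : (2 * k + 1 : ℝ) ≤ n := by exact_mod_cast hk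
  have hk0 : (0 : ℝ) ≤ k := k.cast_nonneg
  have hnR : (1000 : ℝ) ≤ n := by exact_mod_cast hn
  rcases le_total k (8 * n / 25) with hle | hle
  · have h := loadBound_anti hle (show 8 * n / 25 ≤ n by omega)
    have h' : (((n - 8 * n / 25 + 1).choose 2 + 8 * n / 25 + 1 : ℕ) : ℝ)
        ≤ ((n - k + 1).choose 2 : ℕ) + k + 1 := by exact_mod_cast h
    have : (0 : ℝ) ≤ (n - k) * ((k + 1) * (n - 2 * k)) :=
      mul_nonneg (by linarith) (mul_nonneg (by linarith) (by linarith))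
    linarith
  · have e1 : (8 * n / 25) * 25 ≤ 8 * n := Nat.div_mul_le_self _ _
    have e2 : 8 * n < (8 * n / 25) * 25 + 25 := by omega
    generalize 8 * n / 25 = m at *
    have e1' : (m : ℝ) * 25 ≤ 8 * n := by exact_mod_cast e1
    have e2' : (8 * n : ℝ) < m * 25 + 25 := by exact_mod_cast e2
    have hmk : (m : ℝ) ≤ k := by exact_mod_cast hle
    push_cast
    rw [Nat.cast_choose_two, Nat.cast_choose_two]
    push_cast [show m ≤ n by omega, show k ≤ n by omega]
    -- To leading order twice the threshold is (17/25)² n² = 0.4624 n². If n - 2k ≥ 3, the right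
    -- side is at least 3 · (1/2) · (8/25) n² = 0.48 n². For n - 2k = 1 or 2 it is only bounded
    -- below by n²/4, and the subtracted load term, about n²/4, is needed as well.
    by_cases h3 : 2 * k + 3 ≤ n
    · have h3' : (2 * k + 3 : ℝ) ≤ n := by exact_mod_cast h3
      have hA : (n - m + 1 : ℝ) * (n - m + 1 - 1) ≤ (17 / 25 * n + 2) * (17 / 25 * n + 1) := by
        apply mul_le_mul <;> linarith
      have hB : (n / 2 : ℝ) * ((8 / 25 * n) * 3) ≤ (n - k) * ((k + 1) * (n - 2 * k)) := by
        apply mul_le_mul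
        · linarith
        · apply mul_le_mul <;> linarith
        · positivity
        · linarith
      have hC : (0 : ℝ) ≤ (n - k + 1) * (n - k + 1 - 1) := mul_nonneg (by linarith) (by linarith)
      nlinarith
    · have h3' : (n : ℝ) ≤ 2 * k + 2 := by exact_mod_cast (by omega : n ≤ 2 * k + 2)
      have hA : (n - m + 1 : ℝ) * (n - m + 1 - 1) ≤ (17 / 25 * n + 2) * (17 / 25 * n + 1) := by
        apply mul_le_mul <;> linarith
      have hB : (n / 2 : ℝ) * ((n / 2) * 1) ≤ (n - k) * ((k + 1) * (n - 2 * k)) := by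
        apply mul_le_mul
        · linarith
        · apply mul_le_mul <;> linarith
        · positivity
        · linarith
      have hC : (n / 2 : ℝ) * (n / 2) ≤ (n - k + 1) * (n - k + 1 - 1) := by
        apply mul_le_mul <;> linarith
      nlinarith

/-! ### Assembly of part (a) -/

lemma card_layer_reversal {r s : ℕ} (h : r + s = 2 * n) : #(layer n 2 r) = #(layer n 2 s) := by
  rw [← card_image_reversal (layer n 2 r)]
  refine congrArg card (ext fun x => ?_)
  have := rank_reversal x
  simp only [mem_image_reversal, layer, mem_filter, mem_univ, true_and]
  omega

lemma middleSize_three (hn : 1 ≤ n) :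
    middleSize 3 n 2 = #(layer n 2 n) + 2 * #(layer n 2 (n + 1)) := by
  have e : middleRanks n 2 3 = {n - 1, n, n + 1} := by
    ext t
    simp only [middleRanks, mem_filter, mem_range, mem_insert, mem_singleton]
    omega
  rw [middleSize, e, sum_insert (by simp; omega), sum_insert (by simp), sum_singleton,
    card_layer_reversal (r := n - 1) (s := n + 1) (by omega)]
  ring

lemma isCentered_of_forall {F : Finset (Grid n 2)} (h1 : ∀ A ∈ F, n ≤ rank A + 1 ∧ rank A ≤ n + 1)
    (h2 : layer n 2 n ⊆ F ∨ F ⊆ layer n 2 n) : IsCentered F := by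
  intro A B hA hB
  have hmid : ∀ C : Grid n 2, rank C = n → |(rank C : ℝ) - (n : ℝ) * ((2 : ℕ) : ℝ) / 2| = 0 := by
    intro C hC
    rw [hC]; simp
  rcases h2 with h2 | h2
  · have hBn : rank B ≠ n := fun h => hB (h2 (mem_filter.2 ⟨mem_univ _, h⟩))
    have hA1 : |(rank A : ℝ) - (n : ℝ) * ((2 : ℕ) : ℝ) / 2| ≤ 1 := by
      obtain ⟨h3, h4⟩ := h1 A hA
      have h3 : (n : ℝ) ≤ rank A + 1 := by exact_mod_cast h3
      have h4 : (rank A : ℝ) ≤ n + 1 := by exact_mod_cast h4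
      rw [abs_le]
      constructor <;> push_cast <;> linarith
    have hB1 : 1 ≤ |(rank B : ℝ) - (n : ℝ) * ((2 : ℕ) : ℝ) / 2| := by
      rw [le_abs]
      rcases lt_or_gt_of_ne hBn with h | h
      · right
        have h : (rank B : ℝ) + 1 ≤ n := by exact_mod_cast h
        push_cast; linarith
      · left
        have h : (n : ℝ) + 1 ≤ rank B := by exact_mod_cast h
        push_cast; linarith
    exact hA1.trans hB1
  · rw [hmid A (mem_filter.1 (h2 hA)).2]
    exact abs_nonneg _

/-- With at least 8n/25 coordinates equal to 2 the load is at most θ₀, so only `fewTwos` can be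
lost. -/
lemma card_missing_le (F : Finset (Grid n 2)) {θ₀ : ℕ}
    (hθ₀ : θ₀ = (n - 8 * n / 25 + 1).choose 2 + 8 * n / 25 + 1) :
    #{w | rank w + 1 = n ∧ w ∉ F} ≤ #{w | rank w + 1 = n ∧ w ∉ F ∧ load w ≤ θ₀}
      + #(fewTwos n (8 * n / 25)) := by
  refine (card_le_card fun w hw => ?_).trans (card_union_le _ _)
  simp only [mem_union, mem_filter, mem_univ, true_and, fewTwos] at hw ⊢
  obtain ⟨hr, hw⟩ := hw
  by_cases h : twos w < 8 * n / 25
  · exact Or.inr ⟨hr, h⟩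
  · refine Or.inl ⟨hr, hw, ?_⟩
    have e1 := zeros_add_ones_add_twos w
    rw [load_eq hr, hθ₀]
    exact loadBound_anti (by omega) (by omega)

theorem exists_isOptimal_isCentered (ε : ℝ) (hε : 0 < ε) : ∃ n₀ : ℕ, ∀ n : ℕ, n₀ ≤ n →
    ∀ M : ℕ, (M : ℝ) ≤ (1 - ε) * (middleSize 3 n 2 : ℝ) →
      ∃ F : Finset (Grid n 2), IsOptimal M F ∧ IsCentered F := by
  obtain ⟨J, hJ⟩ := exists_pow_lt_of_lt_one hε (show (10 / 11 : ℝ) < 1 by norm_num)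
  -- The gap between 8/25 and 13/40 is n/200, so J steps of ratio 10/11 fit between them.
  refine ⟨1000 + 200 * J, fun n hn M hM => ?_⟩
  have hn1 : 1000 ≤ n := by omega
  by_cases hML : M ≤ #(layer n 2 n)
  · obtain ⟨F, hF, hFc⟩ := exists_subset_card_eq hML
    have hr : ∀ x ∈ F, rank x = n := fun x hx => (mem_filter.1 (hF hx)).2
    refine ⟨F, ⟨hFc, fun F' _ => ?_⟩, isCentered_of_forall (fun A hA => by rw [hr A hA]; omega) (Or.inr hF)⟩
    rw [comp_eq_zero hr]
    exact Nat.zero_le _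
  · rw [middleSize_three (by omega)] at hM
    have hsize : M ≤ Fintype.card (Grid n 2) := by
      have h1 : (M : ℝ) ≤ ((#(layer n 2 n) + 2 * #(layer n 2 (n + 1)) : ℕ) : ℝ) := by
        refine hM.trans (mul_le_of_le_one_left (by positivity) (by linarith))
      have h1 : M ≤ #(layer n 2 n) + 2 * #(layer n 2 (n + 1)) := by exact_mod_cast h1
      have h2 := card_layer_reversal (n := n) (r := n - 1) (s := n + 1) (by omega)
      have h3 : #(layer n 2 n) + #(layer n 2 (n + 1)) + #(layer n 2 (n - 1)) ≤ #(univ : Finset (Grid n 2)) := by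
        rw [← card_union_of_disjoint, ← card_union_of_disjoint]
        · exact card_le_card (subset_univ _)
        · refine disjoint_left.2 fun x hx hx' => ?_
          simp only [layer, mem_union, mem_filter, mem_univ, true_and] at hx hx'
          omega
        · refine disjoint_left.2 fun x hx hx' => ?_
          simp only [layer, mem_filter, mem_univ, true_and] at hx hx'
          omega
      rw [card_univ] at h3
      omega
    obtain ⟨F, hopt, htight⟩ := exists_isOptimal_isTight hsize
    have hlayer := htight.layer_subset (by rw [hopt.1]; omega)
    refine ⟨F, hopt, isCentered_of_forall (htight.rank_mem (by omega)
      (loadBound_le_choose_three hn1) (fun k hk => two_mul_sub_loadBound_le hn1 hk) ?_)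
      (Or.inl hlayer)⟩
    generalize hθ₀ : (n - 8 * n / 25 + 1).choose 2 + 8 * n / 25 + 1 = θ₀
    have hm := card_missing_le F hθ₀.symm
    have hp := card_missing_le (F.image reversal) hθ₀.symm
    have e1 : #{w : Grid n 2 | rank w + 1 = n ∧ w ∉ F.image reversal} = #{w | rank w = n + 1 ∧ w ∉ F} := by
      rw [← card_image_reversal]
      refine congrArg card (ext fun w => ?_)
      have := rank_reversal w
      simp only [mem_image_reversal, mem_filter, mem_univ, true_and, reversal_reversal]
      exact and_congr_left fun _ => by omega
    have e2 : #{w : Grid n 2 | rank w + 1 = n ∧ w ∉ F.image reversal ∧ load w ≤ θ₀}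
        = #{w | rank w = n + 1 ∧ w ∉ F ∧ load (reversal w) ≤ θ₀} := by
      rw [← card_image_reversal]
      refine congrArg card (ext fun w => ?_)
      have := rank_reversal w
      simp only [mem_image_reversal, mem_filter, mem_univ, true_and, reversal_reversal]
      exact and_congr_left fun _ => by omega
    rw [e1, e2] at hp
    have hT := card_fewTwos_le_pow (n := n) (m := 8 * n / 25) J (by omega) hn1
    have e3 : #{w : Grid n 2 | rank w + 1 = n} = #(layer n 2 (n + 1)) := by
      rw [← card_layer_reversal (n := n) (r := n - 1) (s := n + 1) (by omega), layer]
      exact congrArg card (filter_congr fun w _ => by omega)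
    have e4 : #{w | rank w + 1 = n ∧ w ∉ F} + #{w ∈ F | rank w + 1 = n} = #(layer n 2 (n + 1)) := by
      rw [← e3, ← card_union_of_disjoint]
      · refine congrArg card (ext fun w => ?_)
        simp only [mem_union, mem_filter, mem_univ, true_and]
        tauto
      · refine disjoint_left.2 fun x hx hx' => ?_
        simp only [mem_filter, mem_univ, true_and] at hx hx'
        tauto
    have e5 : #{w | rank w = n + 1 ∧ w ∉ F} + #{w ∈ F | rank w = n + 1} = #(layer n 2 (n + 1)) := by
      rw [layer, ← card_union_of_disjoint]
      · refine congrArg card (ext fun w => ?_)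
        simp only [mem_union, mem_filter, mem_univ, true_and]
        tauto
      · refine disjoint_left.2 fun x hx hx' => ?_
        simp only [mem_filter, mem_univ, true_and] at hx hx'
        tauto
    have e6 : #(layer n 2 n) + #{w ∈ F | rank w + 1 = n} + #{w ∈ F | rank w = n + 1}
        + #{x ∈ F | n + 2 ≤ rank x} + #{x ∈ F | rank x + 2 ≤ n} ≤ M := by
      rw [← hopt.1, ← card_union_of_disjoint, ← card_union_of_disjoint, ← card_union_of_disjoint,
        ← card_union_of_disjoint]
      · refine card_le_card fun w hw => ?_
        simp only [mem_union, mem_filter] at hw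
        rcases hw with (((hw | hw) | hw) | hw) | hw
        · exact hlayer hw
        all_goals exact hw.1
      all_goals
        refine disjoint_left.2 fun x hx hx' => ?_
        simp only [layer, mem_union, mem_filter, mem_univ, true_and] at hx hx'
        omega
    rw [e3] at hT
    have hT' : (#(fewTwos n (8 * n / 25)) : ℝ) ≤ ε * #(layer n 2 (n + 1)) :=
      hT.trans (by gcongr)
    have e6' : (#(layer n 2 n) + #{w ∈ F | rank w + 1 = n} + #{w ∈ F | rank w = n + 1}
        + #{x ∈ F | n + 2 ≤ rank x} + #{x ∈ F | rank x + 2 ≤ n} : ℝ) ≤ M := by exact_mod_cast e6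
    have hL0 : (0 : ℝ) ≤ ε * #(layer n 2 n) := by positivity
    push_cast at hM
    -- The bound on M leaves the missing elements of ranks n ± 1 ahead of the outer members by at
    -- least 2ε times the size of layer n + 1, which covers the exceptional elements on both sides.
    have hfin : (#{w ∈ F | rank w + 1 = n} + #{w ∈ F | rank w = n + 1}
        + #{x ∈ F | n + 2 ≤ rank x} + #{x ∈ F | rank x + 2 ≤ n}
        + 2 * #(fewTwos n (8 * n / 25)) : ℝ) ≤ 2 * #(layer n 2 (n + 1)) := by linarith
    have hfin' : #{w ∈ F | rank w + 1 = n} + #{w ∈ F | rank w = n + 1}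
        + #{x ∈ F | n + 2 ≤ rank x} + #{x ∈ F | rank x + 2 ≤ n}
        + 2 * #(fewTwos n (8 * n / 25)) ≤ 2 * #(layer n 2 (n + 1)) := by exact_mod_cast hfin
    omega

/-! ### Raising coordinates by one -/

/-- `y` arises from `x` by raising `i` coordinates from `0` to `1` and `j` coordinates
from `1` to `2`. -/
def Raises (i j : ℕ) (x y : Grid n 2) : Prop :=
  (∀ k, y k = x k ∨ (x k = 0 ∧ y k = 1) ∨ (x k = 1 ∧ y k = 2)) ∧
    #{k | x k = 0 ∧ y k = 1} = i ∧ #{k | x k = 1 ∧ y k = 2} = j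

lemma Raises.le {i j : ℕ} {x y : Grid n 2} (h : Raises i j x y) : x ≤ y := by
  intro k
  rcases h.1 k with h | ⟨h, h'⟩ | ⟨h, h'⟩ <;> rw [h]
  · exact Fin.zero_le _
  · rw [h']; exact (by decide : (1 : Fin (2 + 1)) ≤ 2)

lemma Raises.zeros_add {i j : ℕ} {x y : Grid n 2} (h : Raises i j x y) : zeros y + i = zeros x := by
  rw [← card_filter_zero_ne_zero h.le, ← h.2.1, add_comm]
  congr 2
  refine filter_congr fun k _ => ?_
  rcases h.1 k with h | ⟨h, h'⟩ | ⟨h, h'⟩ <;> simp_all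

lemma Raises.twos_eq {i j : ℕ} {x y : Grid n 2} (h : Raises i j x y) : twos y = twos x + j := by
  rw [← card_filter_two_ne_two h.le, ← h.2.2, add_comm]
  congr 2
  refine filter_congr fun k _ => ?_
  rcases h.1 k with h | ⟨h, h'⟩ | ⟨h, h'⟩ <;> simp_all

lemma Raises.rank_eq {i j : ℕ} {x y : Grid n 2} (h : Raises i j x y) :
    rank y = rank x + i + j := by
  have := h.zeros_add
  have := h.twos_eq
  have := rank_add_zeros x
  have := rank_add_zeros y
  omega

lemma Raises.reversal {i j : ℕ} {x y : Grid n 2} (h : Raises i j x y) :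
    Raises j i (reversal y) (reversal x) := by
  refine ⟨fun k => ?_, ?_, ?_⟩
  · rcases h.1 k with h | ⟨h, h'⟩ | ⟨h, h'⟩
    · exact Or.inl (by simp [CenteredFamilies.reversal, h])
    · right; right; simp only [CenteredFamilies.reversal, h, h']; decide
    · right; left; simp only [CenteredFamilies.reversal, h, h']; decide
  · rw [← h.2.2]
    refine congrArg card (filter_congr fun k _ => ?_)
    rcases fin_three_cases (x k) with hx | hx | hx <;>
      rcases fin_three_cases (y k) with hy | hy | hy <;>
        simp only [CenteredFamilies.reversal, hx, hy] <;> decide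
  · rw [← h.2.1]
    refine congrArg card (filter_congr fun k _ => ?_)
    rcases fin_three_cases (x k) with hx | hx | hx <;>
      rcases fin_three_cases (y k) with hy | hy | hy <;>
        simp only [CenteredFamilies.reversal, hx, hy] <;> decide

lemma card_raises (i j : ℕ) (x : Grid n 2) :
    #{y | Raises i j x y} = (zeros x).choose i * (ones x).choose j := by
  rw [zeros, ones, ← card_powersetCard, ← card_powersetCard, ← card_product]
  refine card_nbij' (fun y => (({k | x k = 0 ∧ y k = 1} : Finset (Fin n)),
    ({k | x k = 1 ∧ y k = 2} : Finset (Fin n))))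
    (fun p k => if k ∈ p.1 then 1 else if k ∈ p.2 then 2 else x k) ?_ ?_ ?_ ?_
  · intro y hy
    simp only [coe_filter, mem_univ, true_and, Set.mem_ofPred_eq] at hy
    simp only [coe_product, Set.mem_prod, mem_coe, mem_powersetCard]
    exact ⟨⟨fun k hk => by simp_all, hy.2.1⟩, ⟨fun k hk => by simp_all, hy.2.2⟩⟩
  · rintro ⟨S, T⟩ h
    simp only [coe_product, Set.mem_prod, mem_coe, mem_powersetCard] at h
    obtain ⟨⟨hS, rfl⟩, ⟨hT, rfl⟩⟩ := h
    have hS' : ∀ k ∈ S, x k = 0 := fun k hk => (mem_filter.1 (hS hk)).2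
    have hT' : ∀ k ∈ T, x k = 1 := fun k hk => (mem_filter.1 (hT hk)).2
    simp only [coe_filter, mem_univ, true_and, Set.mem_ofPred_eq]
    refine ⟨fun k => ?_, congrArg card (ext fun k => ?_), congrArg card (ext fun k => ?_)⟩
    · by_cases h1 : k ∈ S
      · simp [h1, hS' k h1]
      · by_cases h2 : k ∈ T
        · simp [h1, h2, hT' k h2]
        · simp [h1, h2]
    · simp only [mem_filter, mem_univ, true_and]
      by_cases h1 : k ∈ S
      · simp [h1, hS' k h1]
      · by_cases h2 : k ∈ T
        · simp [h1, h2, hT' k h2]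
        · simp only [h1, h2, if_false, iff_false]
          rintro ⟨h3, h4⟩
          rw [h3] at h4
          exact absurd h4 (by decide)
    · simp only [mem_filter, mem_univ, true_and]
      by_cases h1 : k ∈ S
      · have h2 : k ∉ T := fun h2 => by
          have h3 := hS' k h1
          rw [hT' k h2] at h3
          exact absurd h3 (by decide)
        simp [h1, h2, hS' k h1]
      · by_cases h2 : k ∈ T
        · simp [h1, h2, hT' k h2]
        · simp only [h1, h2, if_false, iff_false]
          rintro ⟨h3, h4⟩
          rw [h3] at h4
          exact absurd h4 (by decide)
  · intro y hy
    simp only [coe_filter, mem_univ, true_and, Set.mem_ofPred_eq] at hy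
    funext k
    rcases hy.1 k with h | ⟨h, h'⟩ | ⟨h, h'⟩
    · simp only [mem_filter, mem_univ, true_and, h]
      rw [if_neg, if_neg]
      · rintro ⟨h3, h4⟩
        rw [h3] at h4
        exact absurd h4 (by decide)
      · rintro ⟨h3, h4⟩
        rw [h3] at h4
        exact absurd h4 (by decide)
    · simp [h, h']
    · simp [h, h']
  · rintro ⟨S, T⟩ h
    simp only [coe_product, Set.mem_prod, mem_coe, mem_powersetCard] at h
    obtain ⟨⟨hS, -⟩, ⟨hT, -⟩⟩ := h
    have hS' : ∀ k ∈ S, x k = 0 := fun k hk => (mem_filter.1 (hS hk)).2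
    have hT' : ∀ k ∈ T, x k = 1 := fun k hk => (mem_filter.1 (hT hk)).2
    refine Prod.ext (ext fun k => ?_) (ext fun k => ?_)
    · simp only [mem_filter, mem_univ, true_and]
      by_cases h1 : k ∈ S
      · simp [h1, hS' k h1]
      · by_cases h2 : k ∈ T
        · simp [h1, h2, hT' k h2]
        · simp only [h1, h2, if_false, iff_false]
          rintro ⟨h3, h4⟩
          rw [h3] at h4
          exact absurd h4 (by decide)
    · simp only [mem_filter, mem_univ, true_and]
      by_cases h1 : k ∈ S
      · have h2 : k ∉ T := fun h2 => by
          have h3 := hS' k h1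
          rw [hT' k h2] at h3
          exact absurd h3 (by decide)
        simp [h1, h2, hS' k h1]
      · by_cases h2 : k ∈ T
        · simp [h1, h2, hT' k h2]
        · simp only [h1, h2, if_false, iff_false]
          rintro ⟨h3, h4⟩
          rw [h3] at h4
          exact absurd h4 (by decide)

lemma card_raises_right (i j : ℕ) (y : Grid n 2) :
    #{x | Raises i j x y} = (twos y).choose j * (ones y).choose i := by
  rw [← card_image_reversal, ← zeros_reversal, ← ones_reversal, ← card_raises]
  refine congrArg card (ext fun z => ?_)
  simp only [mem_image_reversal, mem_filter, mem_univ, true_and]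
  exact ⟨fun h => by simpa using h.reversal, fun h => by simpa using h.reversal⟩

/-! ### The outer layers -/

/-- The elements of rank `n + 3` with `a` coordinates equal to `0`. -/
noncomputable def upper (n a : ℕ) : Finset (Grid n 2) := {y | rank y = n + 3 ∧ zeros y = a}

/-- The elements of rank `n - 3` with `a` coordinates equal to `2`. -/
noncomputable def lower (n a : ℕ) : Finset (Grid n 2) := {x | rank x + 3 = n ∧ twos x = a}

/-- A lower bound for the number of comparable pairs between parts of two outer layers. -/
lemma mul_card_add_mul_card_le {a b i j : ℕ} (hij : i + j = 6) (hab : b + i = a + 3)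
    {A B : Finset (Grid n 2)} (hA : A ⊆ lower n a) (hB : B ⊆ upper n b) :
    ((a + 3).choose i * (n - 3 - 2 * a).choose j) * #A
        + ((b + 3).choose j * (n - 3 - 2 * b).choose i) * #B
      ≤ #{p ∈ A ×ˢ B | p.1 < p.2} + ((b + 3).choose j * (n - 3 - 2 * b).choose i) * #(upper n b) := by
  have hup : ∀ x ∈ A, #{y ∈ upper n b | Raises i j x y}
      = (a + 3).choose i * (n - 3 - 2 * a).choose j := by
    intro x hx
    obtain ⟨h1, h2⟩ := (mem_filter.1 (hA hx)).2
    have h3 := rank_add_zeros x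
    have h4 := zeros_add_ones_add_twos x
    rw [← show zeros x = a + 3 by omega, ← show ones x = n - 3 - 2 * a by omega, ← card_raises]
    refine congrArg card (ext fun y => ?_)
    simp only [upper, mem_filter, mem_univ, true_and, and_iff_right_iff_imp]
    intro h
    have := h.rank_eq
    have := h.zeros_add
    omega
  have hdown : ∀ y ∈ upper n b \ B, #{x ∈ A | Raises i j x y}
      ≤ (b + 3).choose j * (n - 3 - 2 * b).choose i := by
    intro y hy
    obtain ⟨h1, h2⟩ := (mem_filter.1 (mem_sdiff.1 hy).1).2
    have h3 := rank_add_zeros y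
    have h4 := zeros_add_ones_add_twos y
    rw [← show twos y = b + 3 by omega, ← show ones y = n - 3 - 2 * b by omega,
      ← card_raises_right]
    exact card_le_card (filter_subset_filter _ (subset_univ _))
  -- `Raises` is biregular between the two classes. Elements outside B absorb only a bounded number
  -- of the edges leaving A; the remaining edges are comparable pairs in A × B.
  have e1 : ∑ x ∈ A, #{y ∈ upper n b \ B | Raises i j x y} ≤ _ :=
    (sum_card_bipartiteAbove_eq_sum_card_bipartiteBelow (Raises i j)).trans_le
      (sum_le_card_nsmul _ _ _ hdown)
  rw [smul_eq_mul, card_sdiff_of_subset hB] at e1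
  have e2 : ∑ x ∈ A, #{y ∈ B | Raises i j x y} ≤ #{p ∈ A ×ˢ B | p.1 < p.2} := by
    rw [card_filter, sum_product]
    refine sum_le_sum fun x hx => ?_
    rw [← card_filter]
    refine card_le_card fun y hy => ?_
    obtain ⟨hy, h⟩ := mem_filter.1 hy
    refine mem_filter.2 ⟨hy, lt_of_le_of_ne h.le fun he => ?_⟩
    have := h.rank_eq
    rw [show x = y from he] at this
    omega
  have e3 : ∑ x ∈ A, #{y ∈ upper n b | Raises i j x y}
      = ∑ x ∈ A, #{y ∈ B | Raises i j x y} + ∑ x ∈ A, #{y ∈ upper n b \ B | Raises i j x y} := by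
    rw [← sum_add_distrib]
    refine sum_congr rfl fun x _ => ?_
    rw [← card_union_of_disjoint (disjoint_filter_filter (disjoint_sdiff)), ← filter_union,
      union_sdiff_of_subset hB]
  rw [sum_congr rfl hup, sum_const, smul_eq_mul] at e3
  have e4 := card_le_card hB
  generalize (b + 3).choose j * (n - 3 - 2 * b).choose i = d' at *
  have e5 : (#(upper n b) - #B) * d' + d' * #B = d' * #(upper n b) := by
    rw [mul_comm, ← mul_add, Nat.sub_add_cancel e4]
  rw [mul_comm _ (#A)]
  omega

/-! ### Degrees of the elements of the outer layers -/

/-- This is (1 + X)² = (1 + X + X²) + X. Passing from class a to class a + 1 trades two factors 1 +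
X for one factor 1 + X + X². -/
lemma cnt_add_two_right (p q j : ℕ) :
    cnt p (q + 2) (j + 1) = cnt (p + 1) q (j + 1) + cnt p q j := by
  rcases j with _ | j
  · rw [zero_add, cnt_one, cnt_one, cnt_zero]
    ring
  · have h1 : cnt p (q + 2) (j + 2) = cnt p (q + 1) (j + 2) + cnt p (q + 1) (j + 1) :=
      cnt_succ_right _ _ _
    have h2 : cnt p (q + 1) (j + 2) = cnt p q (j + 2) + cnt p q (j + 1) := cnt_succ_right _ _ _
    have h3 := cnt_succ_right p q j
    have h4 := cnt_succ_left p q j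
    rw [show j + 1 + 1 = j + 2 from rfl]
    omega

lemma cnt_succ_left_le (p q j : ℕ) : cnt (p + 1) q j ≤ cnt p (q + 2) j := by
  rcases j with _ | j
  · rw [cnt_zero, cnt_zero]
  · rw [cnt_add_two_right]
    exact Nat.le_add_right _ _

/-- The number of elements of the five middle layers comparable to an element of `upper n a`. -/
noncomputable def weight (n a : ℕ) : ℕ := ∑ j ∈ range 5, cnt (a + 3) (n - 3 - 2 * a) (j + 1)

/-- The difference of two consecutive values of `weight`. -/
noncomputable def weightDrop (n a : ℕ) : ℕ := ∑ j ∈ range 5, cnt (a + 3) (n - 5 - 2 * a) j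

lemma weight_eq_add {a : ℕ} (h : 2 * a + 5 ≤ n) :
    weight n a = weight n (a + 1) + weightDrop n a := by
  rw [weight, weight, weightDrop, ← sum_add_distrib,
    show n - 3 - 2 * a = n - 5 - 2 * a + 2 by omega,
    show n - 3 - 2 * (a + 1) = n - 5 - 2 * a by omega]
  exact sum_congr rfl fun j _ => cnt_add_two_right _ _ _

lemma weightDrop_succ_le {a : ℕ} (h : 2 * a + 7 ≤ n) : weightDrop n (a + 1) ≤ weightDrop n a := by
  rw [weightDrop, weightDrop, show n - 5 - 2 * a = n - 5 - 2 * (a + 1) + 2 by omega]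
  exact sum_le_sum fun j _ => cnt_succ_left_le _ _ _

lemma weight_anti {a b : ℕ} (hab : a ≤ b) (hb : 2 * b + 3 ≤ n) : weight n b ≤ weight n a := by
  induction b, hab using Nat.le_induction with
  | base => exact le_rfl
  | succ b hab ih =>
    have := weight_eq_add (n := n) (a := b) (by omega)
    have := ih (by omega)
    omega

/-- Convexity of the weights, from the monotonicity of their differences. Step 3 is the shift
between partner classes. -/
lemma two_mul_weight_le {a : ℕ} (h : 2 * a + 15 ≤ n) :
    2 * weight n (a + 3) ≤ weight n a + weight n (a + 6) := by
  have h0 := weight_eq_add (n := n) (a := a) (by omega)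
  have h1 := weight_eq_add (n := n) (a := a + 1) (by omega)
  have h2 := weight_eq_add (n := n) (a := a + 2) (by omega)
  have h3 := weight_eq_add (n := n) (a := a + 3) (by omega)
  have h4 := weight_eq_add (n := n) (a := a + 4) (by omega)
  have h5 := weight_eq_add (n := n) (a := a + 5) (by omega)
  have d0 := weightDrop_succ_le (n := n) (a := a) (by omega)
  have d1 := weightDrop_succ_le (n := n) (a := a + 1) (by omega)
  have d2 := weightDrop_succ_le (n := n) (a := a + 2) (by omega)
  have d3 := weightDrop_succ_le (n := n) (a := a + 3) (by omega)
  have d4 := weightDrop_succ_le (n := n) (a := a + 4) (by omega)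
  simp only [add_assoc, Nat.reduceAdd] at *
  omega

lemma weight_one_le (hn : 5 ≤ n) : weight n 1 ≤ 5 * (n + 3) ^ 5 := by
  have h : ∀ j ∈ range 5, cnt (1 + 3) (n - 3 - 2 * 1) (j + 1) ≤ (n + 3) ^ 5 := by
    intro j hj
    rw [mem_range] at hj
    refine (cnt_le_choose _ _ _).trans ?_
    rw [show 2 * (1 + 3) + (n - 3 - 2 * 1) = n + 3 by omega]
    exact (Nat.choose_le_pow _ _).trans (Nat.pow_le_pow_right (by omega) (by omega))
  simpa [weight] using sum_le_card_nsmul _ _ _ h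

/-! ### Weights of order n^5 against degrees of order n^6 -/

lemma pow_le_factorial_mul_choose {q m k : ℕ} (h : q + k ≤ m + 1) :
    q ^ k ≤ k.factorial * m.choose k := by
  rw [← Nat.descFactorial_eq_factorial_mul_choose]
  exact (Nat.pow_le_pow_left (by omega) k).trans (Nat.pow_sub_le_descFactorial m k)

lemma two_mul_choose_le (m k : ℕ) : 2 * m.choose (k + 1) ≤ (2 * m).choose (k + 1) := by
  rw [two_mul m, Nat.add_choose_eq]
  have h := sum_le_sum_of_subset (f := fun ij : ℕ × ℕ => m.choose ij.1 * m.choose ij.2)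
    (show {(0, k + 1), (k + 1, 0)} ⊆ antidiagonal (k + 1) by
      intro p hp
      simp only [mem_insert, mem_singleton] at hp
      rcases hp with rfl | rfl <;> simp)
  rw [sum_pair (by simp)] at h
  simp only [Nat.choose_zero_right] at h
  omega

lemma mul_weight_one_le (hn : 10 ^ 10 ≤ n) : 720 * weight n 1 ≤ (n / 10) ^ 6 := by
  have h := weight_one_le (n := n) (by omega)
  have h1 : n + 3 ≤ 11 * (n / 10) := by omega
  have h2 : 10 ^ 9 ≤ n / 10 := by omega
  have h3 := Nat.pow_le_pow_left h1 5
  generalize n / 10 = q at *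
  calc 720 * weight n 1 ≤ 720 * (5 * (11 * q) ^ 5) := by omega
    -- This constant is below 10^9 ≤ n / 10, which is where the threshold 10^10 comes from.
    _ = 579783600 * q ^ 5 := by ring
    _ ≤ q * q ^ 5 := Nat.mul_le_mul_right _ (by omega)
    _ = q ^ 6 := by ring

lemma weight_one_le_choose_six (hn : 10 ^ 10 ≤ n) {m : ℕ} (hm : n / 10 + 6 ≤ m + 1) :
    weight n 1 ≤ m.choose 6 := by
  have h1 := mul_weight_one_le hn
  have h2 := pow_le_factorial_mul_choose hm
  rw [show Nat.factorial 6 = 720 from rfl] at h2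
  omega

lemma weight_one_le_choose_three_mul (hn : 10 ^ 10 ≤ n) {m k : ℕ} (hm : n / 10 + 3 ≤ m + 1)
    (hk : n / 10 + 3 ≤ k + 1) : weight n 1 ≤ m.choose 3 * k.choose 3 := by
  have h1 := mul_weight_one_le hn
  have h2 := Nat.mul_le_mul (pow_le_factorial_mul_choose hm) (pow_le_factorial_mul_choose hk)
  rw [show Nat.factorial 3 = 6 from rfl] at h2
  have h3 : (n / 10) ^ 6 ≤ 36 * (m.choose 3 * k.choose 3) := by
    calc (n / 10) ^ 6 = (n / 10) ^ 3 * (n / 10) ^ 3 := by ring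
      _ ≤ _ := h2
      _ = _ := by ring
  omega

lemma add_le_choose_four {m : ℕ} (hm : 1000 ≤ m) : m + 4 + (m + 5).choose 3 ≤ (m + 2).choose 4 := by
  have h1 := pow_le_factorial_mul_choose (q := m - 1) (m := m + 2) (k := 4) (by omega)
  have h2 := Nat.choose_le_pow (m + 5) 3
  rw [show Nat.factorial 4 = 24 from rfl] at h1
  obtain ⟨r, rfl⟩ : ∃ r, m = r + 1 := ⟨m - 1, by omega⟩
  have h3 : (r + 1 + 5) ^ 3 ≤ (2 * r) ^ 3 := Nat.pow_le_pow_left (by omega) 3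
  have h4 : 900 * r ^ 3 ≤ (r + 1 - 1) ^ 4 := by
    rw [Nat.add_sub_cancel, pow_succ r 3, mul_comm]
    exact Nat.mul_le_mul_left _ (by omega)
  have h5 : (2 * r) ^ 3 = 8 * r ^ 3 := by ring
  have h6 : r * 1 ≤ r * r ^ 2 := Nat.mul_le_mul_left _ (Nat.one_le_pow _ _ (by omega))
  have h7 : r * r ^ 2 = r ^ 3 := by ring
  omega

/-- An element of rank `n - 2` without `2`s has a larger degree than the elements of
`upper n 1`. -/
lemma weight_one_add_lt (hn : 2000 ≤ n) :
    weight n 1 + n.choose 3 < ∑ j ∈ range 5, cnt 2 (n - 2) (j + 1) := by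
  obtain ⟨m, rfl⟩ : ∃ m, n = m + 5 := ⟨n - 5, by omega⟩
  rw [weight, show m + 5 - 3 - 2 * 1 = m by omega, show m + 5 - 2 = m + 3 by omega]
  -- The identity (1 + X)³ = (1 + X + X²)² + X - X³ - X⁴, multiplied by (1 + X + X²)²(1 + X)^m.
  -- Summed over the five levels the difference telescopes to c₃ + c₄ - c₀ - c₁ with c = `cnt 2 m`,
  -- and c₄, of order n⁴, beats C(n,3).
  have key : ∀ j, cnt 2 (m + 3) (j + 4) + cnt 2 m (j + 1) + cnt 2 m j
      = cnt 4 m (j + 4) + cnt 2 m (j + 3) := by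
    intro j
    have a1 : cnt 2 (m + 3) (j + 4) = cnt 2 (m + 2) (j + 4) + cnt 2 (m + 2) (j + 3) :=
      cnt_succ_right _ _ _
    have a2 : cnt 2 (m + 2) (j + 4) = cnt 3 m (j + 4) + cnt 2 m (j + 3) := cnt_add_two_right _ _ _
    have a3 : cnt 2 (m + 2) (j + 3) = cnt 3 m (j + 3) + cnt 2 m (j + 2) := cnt_add_two_right _ _ _
    have a4 : cnt 4 m (j + 4) = cnt 3 m (j + 4) + cnt 3 m (j + 3) + cnt 3 m (j + 2) :=
      cnt_succ_left _ _ _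
    have a5 : cnt 3 m (j + 2) = cnt 2 m (j + 2) + cnt 2 m (j + 1) + cnt 2 m j :=
      cnt_succ_left _ _ _
    omega
  have k4 := key 0
  have k5 := key 1
  have b1 := cnt_one 2 (m + 3)
  have b2 := cnt_one 4 m
  have b3 := cnt_two 2 (m + 3)
  have b4 := cnt_two 4 m
  have c0 := cnt_zero 2 m
  have c1 := cnt_one 2 m
  have c4 := choose_le_cnt 2 m 4
  have hc := add_le_choose_four (m := m) (by omega)
  have d3 : cnt 2 (m + 3) 3 + cnt 2 m 0 = cnt 4 m 3 + cnt 2 m 2 := by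
    have a1 : cnt 2 (m + 3) 3 = cnt 2 (m + 2) 3 + cnt 2 (m + 2) 2 := cnt_succ_right _ _ _
    have a2 : cnt 2 (m + 2) 3 = cnt 3 m 3 + cnt 2 m 2 := cnt_add_two_right _ _ _
    have a3 : cnt 2 (m + 2) 2 = cnt 3 m 2 + cnt 2 m 1 := cnt_add_two_right _ _ _
    have a4 : cnt 4 m 3 = cnt 3 m 3 + cnt 3 m 2 + cnt 3 m 1 := cnt_succ_left _ _ _
    have a5 : cnt 3 m 1 = cnt 2 m 1 + cnt 2 m 0 := cnt_succ_left_one _ _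
    omega
  have d2 : cnt 2 (m + 3) 2 = cnt 4 m 2 + cnt 2 m 1 := by
    have a1 : cnt 2 (m + 3) 2 = cnt 2 (m + 2) 2 + cnt 2 (m + 2) 1 := cnt_succ_right _ _ _
    have a2 : cnt 2 (m + 2) 2 = cnt 3 m 2 + cnt 2 m 1 := cnt_add_two_right _ _ _
    have a3 : cnt 2 (m + 2) 1 = cnt 3 m 1 + cnt 2 m 0 := cnt_add_two_right _ _ _
    have a4 : cnt 4 m 2 = cnt 3 m 2 + cnt 3 m 1 + cnt 3 m 0 := cnt_succ_left _ _ _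
    have a5 := cnt_zero 3 m
    omega
  rw [add_comm 2 m] at c4
  simp only [sum_range_succ, sum_range_zero, zero_add, Nat.reduceAdd] at *
  omega

/-! ### Comparable pairs between the outer layers -/

/-- The excess of the parts `X` and `Y` of the layers of rank `n - 3` and `n + 3` over a whole
layer, among the elements indexed by `a`. -/
noncomputable def excess (X Y : Finset (Grid n 2)) (a : ℕ) : ℤ :=
  #{x ∈ X | twos x = a} + #{y ∈ Y | zeros y = a} - #(upper n a)

/-- The comparable pairs between the classes indexed by `a` and `b`. -/
noncomputable def classPairs (X Y : Finset (Grid n 2)) (a b : ℕ) : Finset (Grid n 2 × Grid n 2) :=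
  {p ∈ X ×ˢ Y | p.1 < p.2 ∧ (twos p.1 = a ∧ zeros p.2 = b ∨ twos p.1 = b ∧ zeros p.2 = a)}

lemma filter_twos_subset_lower {X : Finset (Grid n 2)} (hX : ∀ x ∈ X, rank x + 3 = n) (a : ℕ) :
    {x ∈ X | twos x = a} ⊆ lower n a := fun x hx => by
  obtain ⟨h1, h2⟩ := mem_filter.1 hx
  exact mem_filter.2 ⟨mem_univ _, hX x h1, h2⟩

lemma filter_zeros_subset_upper {Y : Finset (Grid n 2)} (hY : ∀ y ∈ Y, rank y = n + 3) (a : ℕ) :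
    {y ∈ Y | zeros y = a} ⊆ upper n a := fun y hy => by
  obtain ⟨h1, h2⟩ := mem_filter.1 hy
  exact mem_filter.2 ⟨mem_univ _, hY y h1, h2⟩

/-- The biregular bound is used for (X_a, Y_b) and for (X_b, Y_a); by symmetry the same two degrees
occur, so the sizes combine into the two excesses. -/
lemma mul_excess_add_mul_excess_le {X Y : Finset (Grid n 2)} (hX : ∀ x ∈ X, rank x + 3 = n)
    (hY : ∀ y ∈ Y, rank y = n + 3) {a b i j : ℕ} (hij : i + j = 6) (hab : b + i = a + 3)
    (hne : a ≠ b) :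
    (((a + 3).choose i * (n - 3 - 2 * a).choose j : ℕ) : ℤ) * excess X Y a
      + (((b + 3).choose j * (n - 3 - 2 * b).choose i : ℕ) : ℤ) * excess X Y b
      ≤ #(classPairs X Y a b) := by
  have h1 := mul_card_add_mul_card_le hij hab (filter_twos_subset_lower hX a)
    (filter_zeros_subset_upper hY b)
  have h2 := mul_card_add_mul_card_le (a := b) (b := a) (i := j) (j := i) (by omega) (by omega)
    (filter_twos_subset_lower hX b) (filter_zeros_subset_upper hY a)
  have h3 : #{p ∈ {x ∈ X | twos x = a} ×ˢ {y ∈ Y | zeros y = b} | p.1 < p.2}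
      + #{p ∈ {x ∈ X | twos x = b} ×ˢ {y ∈ Y | zeros y = a} | p.1 < p.2}
      ≤ #(classPairs X Y a b) := by
    rw [← card_union_of_disjoint]
    · refine card_le_card fun p hp => ?_
      simp only [classPairs, mem_union, mem_filter, mem_product] at hp ⊢
      tauto
    · refine disjoint_left.2 fun p hp hp' => ?_
      simp only [mem_filter, mem_product] at hp hp'
      omega
  simp only [excess]
  generalize (a + 3).choose i * (n - 3 - 2 * a).choose j = d at *
  generalize (b + 3).choose j * (n - 3 - 2 * b).choose i = d' at *
  rw [← Nat.cast_le (α := ℤ)] at h1 h2 h3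
  push_cast at h1 h2 h3
  linarith

lemma mul_excess_le {X Y : Finset (Grid n 2)} (hX : ∀ x ∈ X, rank x + 3 = n)
    (hY : ∀ y ∈ Y, rank y = n + 3) (a : ℕ) :
    (((a + 3).choose 3 * (n - 3 - 2 * a).choose 3 : ℕ) : ℤ) * excess X Y a
      ≤ #(classPairs X Y a a) := by
  have h1 := mul_card_add_mul_card_le (a := a) (b := a) (i := 3) (j := 3) rfl rfl
    (filter_twos_subset_lower hX a) (filter_zeros_subset_upper hY a)
  have h3 : #{p ∈ {x ∈ X | twos x = a} ×ˢ {y ∈ Y | zeros y = a} | p.1 < p.2}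
      ≤ #(classPairs X Y a a) := by
    refine card_le_card fun p hp => ?_
    simp only [classPairs, mem_filter, mem_product] at hp ⊢
    tauto
  simp only [excess]
  generalize (a + 3).choose 3 * (n - 3 - 2 * a).choose 3 = d at *
  rw [← Nat.cast_le (α := ℤ)] at h1 h3
  push_cast at h1 h3
  linarith

/-- The class paired with the class indexed by `a`. -/
def partner (n a : ℕ) : ℕ := if 4 * a ≤ n then a + 3 else if 5 * a < 2 * n + 3 then a else a - 3

/-- With s, s' the excesses of a class and its partner, F, F' their gains over class 1 and d, d' the
degrees: a positive excess is paid for by comparable pairs or by a deficit of the partner class. -/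
lemma mul_posPart_le {d d' F F' s s' E : ℤ} (hF : 0 ≤ F) (hF' : 0 ≤ F') (hd' : 0 ≤ d')
    (hd : F ≤ d) (h : d' * F ≤ d * F') (hE : 0 ≤ E) (hs : d * s + d' * s' ≤ E) :
    F * s ≤ E + F' * max (-s') 0 := by
  rcases le_or_gt s 0 with h0 | h0
  · have := mul_nonneg hF' (le_max_right (-s') 0)
    have := mul_nonneg hF (neg_nonneg.2 h0)
    linarith
  · have hds : F * s ≤ d * s := mul_le_mul_of_nonneg_right hd h0.le
    rcases le_or_gt 0 s' with h1 | h1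
    · have := mul_nonneg hF' (le_max_right (-s') 0)
      have := mul_nonneg hd' h1
      linarith
    · rw [max_eq_left (by linarith)]
      by_contra hcon
      rw [not_le] at hcon
      have hFpos : 0 < F := by
        rcases hF.eq_or_lt with h2 | h2
        · rw [← h2] at hcon
          have := mul_nonneg hF' (neg_nonneg.2 h1.le)
          linarith
        · exact h2
      have h2 : (d - F) * (F' * -s') ≤ (d - F) * (F * s) :=
        mul_le_mul_of_nonneg_left (by linarith) (by linarith)
      have h3 : d' * F * -s' ≤ d * F' * -s' := mul_le_mul_of_nonneg_right h (by linarith)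
      have h4 : F * (d * s + d' * s') < F * (F * s - F' * -s') :=
        mul_lt_mul_of_pos_left (by linarith) hFpos
      nlinarith

/-- The partner is chosen so that the degree d from class a is of order n^6 and d' F ≤ d F'. For
small a six 1s become 2s, and d' ≤ d, F ≤ F'. In the middle range the class is paired with itself.
For large a six 0s become 1s; there F may exceed F', but convexity gives F ≤ 2F', and 2d' ≤ d holds.
-/
lemma weight_mul_excess_le (hn : 10 ^ 10 ≤ n) {X Y : Finset (Grid n 2)}
    (hX : ∀ x ∈ X, rank x + 3 = n) (hY : ∀ y ∈ Y, rank y = n + 3) {a : ℕ} (ha : 2 ≤ a)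
    (han : 2 * a + 3 ≤ n) :
    ((weight n 1 : ℤ) - weight n a) * excess X Y a ≤ #(classPairs X Y a (partner n a))
      + if partner n a ≠ a then ((weight n 1 : ℤ) - weight n (partner n a))
          * max (-excess X Y (partner n a)) 0 else 0 := by
  have hF : (weight n a : ℤ) ≤ weight n 1 := by
    exact_mod_cast weight_anti (n := n) (a := 1) (b := a) (by omega) han
  have hFd : (weight n 1 : ℤ) - weight n a ≤ weight n 1 := by
    have : (0 : ℤ) ≤ weight n a := by positivity
    linarith
  unfold partner
  split_ifs with h1 h2 h3 h4 h5
  · have hF' : (weight n (a + 3) : ℤ) ≤ weight n a := by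
      exact_mod_cast weight_anti (n := n) (a := a) (b := a + 3) (by omega) (by omega)
    have hs := mul_excess_add_mul_excess_le hX hY (a := a) (b := a + 3) (i := 0) (j := 6) rfl rfl
      (by omega)
    simp only [Nat.choose_zero_right, one_mul, mul_one] at hs
    have hdd : (((a + 3 + 3).choose 6 : ℕ) : ℤ) ≤ ((n - 3 - 2 * a).choose 6 : ℕ) := by
      exact_mod_cast Nat.choose_le_choose 6 (by omega)
    have hd : (weight n 1 : ℤ) ≤ ((n - 3 - 2 * a).choose 6 : ℕ) := by
      exact_mod_cast weight_one_le_choose_six hn (by omega)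
    refine mul_posPart_le (by linarith) (by linarith) (by positivity) (hFd.trans hd) ?_
      (by positivity) hs
    exact mul_le_mul hdd (by linarith) (by linarith) (by positivity)
  · omega
  · exact absurd rfl h4
  · have hs := mul_excess_le hX hY a
    have hd : (weight n 1 : ℤ) ≤ ((a + 3).choose 3 * (n - 3 - 2 * a).choose 3 : ℕ) := by
      exact_mod_cast weight_one_le_choose_three_mul hn (by omega) (by omega)
    rw [add_zero]
    rcases le_or_gt (excess X Y a) 0 with h0 | h0
    · have := mul_nonneg (sub_nonneg.2 hF) (neg_nonneg.2 h0)
      have : (0 : ℤ) ≤ #(classPairs X Y a a) := by positivity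
      linarith
    · exact (mul_le_mul_of_nonneg_right (hFd.trans hd) h0.le).trans hs
  · obtain ⟨c, rfl⟩ : ∃ c, a = c + 6 := ⟨a - 6, by omega⟩
    rw [show c + 6 - 3 = c + 3 by omega] at *
    have hF1 : (weight n c : ℤ) ≤ weight n 1 := by
      exact_mod_cast weight_anti (n := n) (a := 1) (b := c) (by omega) (by omega)
    have hF2 : (weight n (c + 3) : ℤ) ≤ weight n c := by
      exact_mod_cast weight_anti (n := n) (a := c) (b := c + 3) (by omega) (by omega)
    have hF3 : 2 * (weight n (c + 3) : ℤ) ≤ weight n c + weight n (c + 6) := by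
      exact_mod_cast two_mul_weight_le (n := n) (a := c) (by omega)
    have hs := mul_excess_add_mul_excess_le hX hY (a := c + 6) (b := c + 3) (i := 6) (j := 0)
      rfl rfl (by omega)
    simp only [Nat.choose_zero_right, one_mul, mul_one] at hs
    -- With a = c + 6, this needs 2(n + 3 - 2a) ≤ a + 3, that is 5a ≥ 2n + 3: the cut-off in
    -- `partner`.
    have hdd : 2 * (((n - 3 - 2 * (c + 3)).choose 6 : ℕ) : ℤ) ≤ ((c + 6 + 3).choose 6 : ℕ) := by
      exact_mod_cast (two_mul_choose_le _ 5).trans (Nat.choose_le_choose 6 (by omega))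
    have hd : (weight n 1 : ℤ) ≤ ((c + 6 + 3).choose 6 : ℕ) := by
      exact_mod_cast weight_one_le_choose_six hn (by omega)
    refine mul_posPart_le (by linarith) (by linarith) (by positivity) (hFd.trans hd) ?_
      (by positivity) hs
    have h6 : ((n - 3 - 2 * (c + 3)).choose 6 : ℕ) * ((weight n 1 : ℤ) - weight n (c + 6))
        ≤ ((n - 3 - 2 * (c + 3)).choose 6 : ℕ) * (2 * ((weight n 1 : ℤ) - weight n (c + 3))) :=
      mul_le_mul_of_nonneg_left (by linarith) (by positivity)
    have h7 := mul_le_mul_of_nonneg_right hdd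
      (show (0 : ℤ) ≤ (weight n 1 : ℤ) - weight n (c + 3) by linarith)
    linarith
  · omega

lemma sum_weight_mul_excess_le (hn : 10 ^ 10 ≤ n) {X Y : Finset (Grid n 2)}
    (hX : ∀ x ∈ X, rank x + 3 = n) (hY : ∀ y ∈ Y, rank y = n + 3) :
    ∑ a ∈ Ico 2 ((n - 1) / 2), ((weight n 1 : ℤ) - weight n a) * excess X Y a
      ≤ #{p ∈ X ×ˢ Y | p.1 < p.2} := by
  set S := Ico 2 ((n - 1) / 2) with hS
  set g : ℕ → ℤ := fun a => ((weight n 1 : ℤ) - weight n a) * max (-excess X Y a) 0 with hg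
  have hF : ∀ a ∈ S, (0 : ℤ) ≤ (weight n 1 : ℤ) - weight n a := by
    intro a ha
    rw [hS, mem_Ico] at ha
    rw [sub_nonneg]
    exact_mod_cast weight_anti (n := n) (a := 1) (b := a) (by omega) (by omega)
  have hg0 : ∀ a ∈ S, 0 ≤ g a := fun a ha => mul_nonneg (hF a ha) (le_max_right _ _)
  have hpS : ∀ a ∈ S, partner n a ∈ S := by
    intro a ha
    rw [hS, mem_Ico] at *
    unfold partner
    split_ifs <;> omega
  have hloc : ∀ a ∈ S, ((weight n 1 : ℤ) - weight n a) * excess X Y a ≤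
      #(classPairs X Y a (partner n a)) + (if partner n a ≠ a then g (partner n a) else 0)
        - g a := by
    intro a ha
    have h2 := mem_Ico.1 (hS ▸ ha)
    rcases le_or_gt (excess X Y a) 0 with h0 | h0
    · have h3 : g a = ((weight n 1 : ℤ) - weight n a) * -excess X Y a := by
        rw [hg]
        simp only
        rw [max_eq_left (by linarith)]
      have h4 : (0 : ℤ) ≤ if partner n a ≠ a then g (partner n a) else 0 := by
        split_ifs
        · exact hg0 _ (hpS a ha)
        · exact le_rfl
      have : (0 : ℤ) ≤ #(classPairs X Y a (partner n a)) := by positivity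
      rw [h3]
      linarith
    · have h3 : g a = 0 := by
        rw [hg]
        simp only
        rw [max_eq_right (by linarith), mul_zero]
      rw [h3, sub_zero]
      exact weight_mul_excess_le hn hX hY h2.1 (by omega)
  have hsum := sum_le_sum hloc
  rw [sum_sub_distrib, sum_add_distrib, ← sum_filter] at hsum
  -- Upward and downward shifts have disjoint ranges, so the deficit of each class is spent at most
  -- once.
  have hinj : Set.InjOn (partner n) (S.filter fun a => partner n a ≠ a : Finset ℕ) := by
    intro a ha b hb hab
    simp only [coe_filter, hS, mem_Ico, Set.mem_ofPred_eq] at ha hb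
    unfold partner at *
    split_ifs at * <;> omega
  have h1 : ∑ a ∈ S with partner n a ≠ a, g (partner n a) ≤ ∑ a ∈ S, g a := by
    rw [← sum_image hinj]
    refine sum_le_sum_of_subset_of_nonneg (fun b hb => ?_) fun b hb _ => hg0 b hb
    obtain ⟨a, ha, rfl⟩ := mem_image.1 hb
    exact hpS a (mem_filter.1 ha).1
  have h2 : ∑ a ∈ S, #(classPairs X Y a (partner n a)) ≤ #{p ∈ X ×ˢ Y | p.1 < p.2} := by
    rw [← card_biUnion]
    · refine card_le_card fun p hp => ?_
      obtain ⟨a, -, hp⟩ := mem_biUnion.1 hp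
      obtain ⟨hp1, hp2, -⟩ := mem_filter.1 hp
      exact mem_filter.2 ⟨hp1, hp2⟩
    -- No two classes are partners of each other, so the unordered pairs {a, partner of a} are
    -- distinct and no comparable pair is charged twice.
    · intro a ha b hb hab
      refine disjoint_left.2 fun p hp hp' => hab ?_
      have h3 := (mem_filter.1 hp).2.2
      have h4 := (mem_filter.1 hp').2.2
      rw [mem_coe, hS, mem_Ico] at ha hb
      unfold partner at h3 h4
      split_ifs at h3 h4 <;> omega
  have h2' : ∑ a ∈ S, (#(classPairs X Y a (partner n a)) : ℤ) ≤ #{p ∈ X ×ˢ Y | p.1 < p.2} := by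
    exact_mod_cast h2
  linarith

/-! ### Families consisting of the five middle layers and parts of the next two -/

/-- The union of the five middle layers. -/
noncomputable def midFive (n : ℕ) : Finset (Grid n 2) := {x | n ≤ rank x + 2 ∧ rank x ≤ n + 2}

lemma mem_midFive {x : Grid n 2} : x ∈ midFive n ↔ n ≤ rank x + 2 ∧ rank x ≤ n + 2 := by
  simp [midFive]

lemma mem_layer {r : ℕ} {x : Grid n 2} : x ∈ layer n 2 r ↔ rank x = r := by
  simp [layer]

lemma sum_Ioo_zero_six (f : ℕ → ℕ) : ∑ j ∈ Ioo 0 6, f j = ∑ j ∈ range 5, f (j + 1) := by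
  rw [show Ioo 0 6 = {1, 2, 3, 4, 5} from rfl]
  simp [sum_range_succ]
  ring

lemma deg_midFive_of_rank_eq_add (hn : 3 ≤ n) {y : Grid n 2} (hy : rank y = n + 3) :
    deg (midFive n) y = weight n (zeros y) := by
  have h := card_filter_rank_Ioo_below y (n - 3)
  rw [show rank y - (n - 3) = 6 by omega, sum_Ioo_zero_six] at h
  have h1 := rank_add_zeros y
  have h2 := zeros_add_ones_add_twos y
  rw [weight, deg, ← show twos y = zeros y + 3 by omega, ← show ones y = n - 3 - 2 * zeros y by omega,
    ← sum_congr rfl fun j _ => card_below y (j + 1), ← h]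
  refine congrArg card (ext fun z => ?_)
  simp only [mem_filter, mem_midFive, mem_univ, true_and]
  constructor
  · rintro ⟨h3, h4 | h4⟩
    · exact ⟨h4, by omega⟩
    · have := rank_strictMono h4
      omega
  · rintro ⟨h3, h4⟩
    have := rank_strictMono h3
    exact ⟨by omega, Or.inl h3⟩

lemma deg_midFive_of_rank_add_eq {x : Grid n 2} (hx : rank x + 3 = n) :
    deg (midFive n) x = weight n (twos x) := by
  have h := card_filter_rank_Ioo_above x (n + 3)
  rw [show n + 3 - rank x = 6 by omega, sum_Ioo_zero_six] at h
  have h1 := rank_add_zeros x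
  have h2 := zeros_add_ones_add_twos x
  rw [weight, deg, ← show zeros x = twos x + 3 by omega, ← show ones x = n - 3 - 2 * twos x by omega,
    ← sum_congr rfl fun j _ => card_above x (j + 1), ← h]
  refine congrArg card (ext fun z => ?_)
  simp only [mem_filter, mem_midFive, mem_univ, true_and]
  constructor
  · rintro ⟨h3, h4 | h4⟩
    · have := rank_strictMono h4
      omega
    · exact ⟨h4, by omega⟩
  · rintro ⟨h3, h4⟩
    have := rank_strictMono h3
    exact ⟨by omega, Or.inr h3⟩

lemma comp_midFive_union (hn : 3 ≤ n) {X Y : Finset (Grid n 2)} (hX : ∀ x ∈ X, rank x + 3 = n)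
    (hY : ∀ y ∈ Y, rank y = n + 3) :
    comp (midFive n ∪ X ∪ Y) = comp (midFive n) + ∑ x ∈ X, weight n (twos x)
      + ∑ y ∈ Y, weight n (zeros y) + #{p ∈ X ×ˢ Y | p.1 < p.2} := by
  have hGX : Disjoint (midFive n) X := disjoint_left.2 fun x hx hx' => by
    have := mem_midFive.1 hx
    have := hX x hx'
    omega
  have hGXY : Disjoint (midFive n ∪ X) Y := disjoint_left.2 fun x hx hx' => by
    have h1 := hY x hx'
    rcases mem_union.1 hx with hx | hx
    · have := mem_midFive.1 hx
      omega
    · have := hX x hx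
      omega
  have h1 : ∀ y ∈ Y, deg (midFive n ∪ X) y = weight n (zeros y) + #{x ∈ X | x < y} := by
    intro y hy
    rw [← deg_midFive_of_rank_eq_add hn (hY y hy), deg, filter_union, card_union_of_disjoint
      (disjoint_filter_filter hGX), deg]
    congr 2
    refine filter_congr fun x hx => or_iff_left fun h => ?_
    have := rank_strictMono h
    have := hX x hx
    have := hY y hy
    omega
  have h2 : #{p ∈ X ×ˢ Y | p.1 < p.2} = ∑ y ∈ Y, #{x ∈ X | x < y} := by
    rw [card_filter, sum_product_right]
    exact sum_congr rfl fun y _ => (card_filter _ _).symm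
  rw [comp_union hGXY, comp_union hGX, comp_eq_zero hY,
    comp_eq_zero (R := X) (r := n - 3) (fun x hx => by have := hX x hx; omega),
    sum_congr rfl fun x hx => deg_midFive_of_rank_add_eq (hX x hx), sum_congr rfl h1,
    sum_add_distrib, h2]
  ring

lemma sum_excess_mul {X Y : Finset (Grid n 2)} (hX : ∀ x ∈ X, rank x + 3 = n)
    (hY : ∀ y ∈ Y, rank y = n + 3) (g : ℕ → ℤ) :
    ∑ a ∈ range ((n - 1) / 2), g a * excess X Y a
      = ∑ x ∈ X, g (twos x) + ∑ y ∈ Y, g (zeros y) - ∑ y ∈ layer n 2 (n + 3), g (zeros y) := by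
  have key : ∀ (Z : Finset (Grid n 2)) (c : Grid n 2 → ℕ), (∀ z ∈ Z, 2 * c z + 3 ≤ n) →
      ∑ a ∈ range ((n - 1) / 2), g a * #{z ∈ Z | c z = a} = ∑ z ∈ Z, g (c z) := by
    intro Z c hc
    rw [← sum_fiberwise_of_maps_to (t := range ((n - 1) / 2)) (g := c) (fun z hz => by
      have := hc z hz
      rw [mem_range]; omega)]
    refine sum_congr rfl fun a _ => ?_
    rw [sum_congr rfl fun z hz => by rw [(mem_filter.1 hz).2], sum_const, nsmul_eq_mul, mul_comm]
  have hz : ∀ y : Grid n 2, rank y = n + 3 → 2 * zeros y + 3 ≤ n := fun y hy => by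
    have := rank_add_zeros y
    have := zeros_add_ones_add_twos y
    omega
  rw [← key X twos (fun x hx => by
      have := rank_add_zeros x
      have := zeros_add_ones_add_twos x
      have := hX x hx
      omega), ← key Y zeros (fun y hy => hz y (hY y hy)),
    ← key (layer n 2 (n + 3)) zeros (fun y hy => hz y (mem_layer.1 hy)), ← sum_add_distrib,
    ← sum_sub_distrib]
  refine sum_congr rfl fun a _ => ?_
  rw [excess, show upper n a = {y ∈ layer n 2 (n + 3) | zeros y = a} by
    ext y; simp [upper, layer]]
  ring

/-- Without 0s, rank n + 3 means lying three levels above the all-ones vector. -/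
lemma card_upper_zero : #(upper n 0) = n.choose 3 := by
  have h0 : zeros (fun _ => 1 : Grid n 2) = 0 := by simp [zeros]
  have h2 : twos (fun _ => 1 : Grid n 2) = 0 := by simp [twos]
  have hr := rank_add_zeros (fun _ => 1 : Grid n 2)
  have h1 := zeros_add_ones_add_twos (fun _ => 1 : Grid n 2)
  have h := card_above (fun _ => 1 : Grid n 2) 3
  rw [h0, cnt_zero_left, show ones (fun _ => 1 : Grid n 2) = n by omega] at h
  rw [← h]
  refine congrArg card (ext fun y => ?_)
  rw [mem_above, show rank (fun _ => 1 : Grid n 2) = n by omega]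
  simp only [upper, mem_filter, mem_univ, true_and]
  rw [and_comm]
  refine and_congr_left fun _ => ⟨fun h k => ?_, fun h => ?_⟩
  · rw [zeros, card_eq_zero, filter_eq_empty_iff] at h
    have := h (mem_univ k)
    rcases fin_three_cases (y k) with h' | h' | h'
    · exact absurd h' this
    · rw [h']
    · rw [h']; exact (by decide : (1 : Fin (2 + 1)) ≤ 2)
  · have := zeros_anti h
    omega

/-- The number of comparable pairs of a family consisting of the five middle layers and
parts of the next two. -/
lemma comp_add_le (hn : 10 ^ 10 ≤ n) {X Y : Finset (Grid n 2)} (hX : ∀ x ∈ X, rank x + 3 = n)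
    (hY : ∀ y ∈ Y, rank y = n + 3) (hXY : #X + #Y + n.choose 3 + 1 = #(layer n 2 (n + 3))) :
    comp (midFive n ∪ ∅ ∪ {y ∈ layer n 2 (n + 3) | zeros y ≠ 0})
      ≤ comp (midFive n ∪ X ∪ Y) + weight n 1 := by
  rw [comp_midFive_union (by omega) hX hY, comp_midFive_union (by omega) (by simp)
    (fun y hy => mem_layer.1 (mem_filter.1 hy).1)]
  have h1 := sum_weight_mul_excess_le hn hX hY
  -- Weights are measured relative to class 1, so the class 1 term vanishes. The classes a ≥ 2 are
  -- handled by `h1`; for class 0 it suffices that the excess is at least -C(n,3).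
  have h2 := sum_excess_mul hX hY fun a => (weight n 1 : ℤ) - weight n a
  rw [range_eq_Ico, sum_eq_sum_Ico_succ_bot (by omega), sum_eq_sum_Ico_succ_bot (by omega)] at h2
  simp only [sub_self, zero_mul, zero_add, Nat.reduceAdd] at h2
  rw [sum_sub_distrib, sum_sub_distrib, sum_sub_distrib] at h2
  simp only [sum_const, nsmul_eq_mul] at h2
  have h3 : ∑ y ∈ layer n 2 (n + 3), weight n (zeros y)
      = n.choose 3 * weight n 0 + ∑ y ∈ layer n 2 (n + 3) with zeros y ≠ 0, weight n (zeros y) := by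
    rw [← sum_filter_add_sum_filter_not _ (fun y => zeros y = 0)]
    congr 1
    rw [sum_congr rfl fun y hy => by rw [(mem_filter.1 hy).2], sum_const, smul_eq_mul,
      ← card_upper_zero]
    congr 2
    ext y; simp [upper, layer]
  have h4 : (weight n 1 : ℤ) ≤ weight n 0 := by
    exact_mod_cast weight_anti (n := n) (a := 0) (b := 1) (by omega) (by omega)
  have h5 : 0 ≤ excess X Y 0 + n.choose 3 := by
    rw [excess, card_upper_zero]
    have : (0 : ℤ) ≤ #{x ∈ X | twos x = 0} := by positivity
    have : (0 : ℤ) ≤ #{y ∈ Y | zeros y = 0} := by positivity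
    linarith
  have h6 := mul_nonneg (sub_nonneg.2 h4) h5
  have h7 : (#(layer n 2 (n + 3)) : ℤ) * weight n 1
      = (#X + #Y + n.choose 3 + 1) * weight n 1 := by
    rw [← hXY]; push_cast; ring
  zify at h3
  simp only [sum_empty, empty_product, filter_empty, card_empty]
  zify
  linarith

/-! ### Failure of the centeredness property -/

/-- This element of rank n - 2 is the one deleted to beat the centered families. -/
lemma exists_rank_sub_two (hn : 2 ≤ n) : ∃ v : Grid n 2, zeros v = 2 ∧ twos v = 0 := by
  refine ⟨fun i => if i.val < 2 then 0 else 1, ?_, ?_⟩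
  · have h : ∀ i : Fin n, (if i.val < 2 then (0 : Fin (2 + 1)) else 1) = 0 ↔ i.val < 2 := by
      intro i
      split_ifs with h <;> simp [h]
    simp only [zeros, h]
    rw [Fin.card_filter_val_lt]
    omega
  · rw [twos, card_eq_zero, filter_eq_empty_iff]
    intro i _
    split_ifs <;> decide

lemma choose_three_add_two_le_card_layer (hn : 2000 ≤ n) :
    n.choose 3 + 2 ≤ #(layer n 2 (n + 3)) := by
  obtain ⟨v, hv0, hv2⟩ := exists_rank_sub_two (n := n) (by omega)
  have hr := rank_add_zeros v
  have h1 := zeros_add_ones_add_twos v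
  have h := card_above v 5
  have h2 := choose_le_cnt 2 (n - 2) 5
  rw [hv0, show ones v = n - 2 by omega] at h
  rw [show 2 + (n - 2) = n by omega] at h2
  have h3 : n.choose 4 ≤ n.choose 5 := Nat.choose_le_succ_of_lt_half_left (by omega)
  obtain ⟨m, rfl⟩ : ∃ m, n = m + 5 := ⟨n - 5, by omega⟩
  have h4 := add_le_choose_four (m := m) (by omega)
  have h5 := Nat.choose_le_choose 4 (show m + 2 ≤ m + 5 by omega)
  have h6 : #(above v 5) ≤ #(layer (m + 5) 2 (m + 5 + 3)) := card_le_card fun z hz => by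
    have := (mem_above.1 hz).2
    rw [mem_layer]
    omega
  omega

lemma middleSize_six (hn : 3 ≤ n) :
    middleSize 6 n 2 = #(midFive n) + #(layer n 2 (n + 3)) := by
  have e : middleRanks n 2 6 = insert (n - 3) (Icc (n - 2) (n + 2)) := by
    ext t
    simp only [middleRanks, mem_filter, mem_range, mem_insert, mem_Icc]
    omega
  rw [middleSize, e, sum_insert (by simp; omega), card_layer_reversal (r := n - 3) (s := n + 3) (by omega),
    add_comm, card_eq_sum_card_fiberwise (s := midFive n) (f := rank) (t := Icc (n - 2) (n + 2))
      (fun x hx => by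
        have := mem_midFive.1 hx
        rw [mem_coe, mem_Icc]; omega)]
  congr 1
  refine sum_congr rfl fun t ht => congrArg card (ext fun x => ?_)
  rw [mem_Icc] at ht
  simp only [mem_layer, mem_filter, mem_midFive]
  omega

lemma IsCentered.abs_rank_le {F : Finset (Grid n 2)} (hF : IsCentered F) {A B : Grid n 2}
    (hA : A ∈ F) (hB : B ∉ F) : |(rank A : ℤ) - n| ≤ |(rank B : ℤ) - n| := by
  have h := hF A B hA hB
  rw [show (n : ℝ) * ((2 : ℕ) : ℝ) / 2 = n by push_cast; ring] at h
  exact_mod_cast h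

/-- A family that is larger than the five middle layers by less than twice the size of the next
layers contains the former and is contained in the union of all of these, if it is centered. -/
lemma IsCentered.exists_eq_midFive_union {F : Finset (Grid n 2)} (hF : IsCentered F) (hn : 3 ≤ n)
    (h1 : #(midFive n) < #F) (h2 : #F < #(midFive n) + 2 * #(layer n 2 (n + 3))) :
    ∃ X Y : Finset (Grid n 2), (∀ x ∈ X, rank x + 3 = n) ∧ (∀ y ∈ Y, rank y = n + 3) ∧
      F = midFive n ∪ X ∪ Y ∧ #F = #(midFive n) + #X + #Y := by
  have hsub : midFive n ⊆ F := by
    intro B hB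
    by_contra hBF
    refine absurd h1 (not_lt.2 (card_le_card fun A hA => ?_))
    have h := hF.abs_rank_le hA hBF
    rw [mem_midFive] at *
    rw [abs_le'] at h
    rcases abs_cases ((rank B : ℤ) - n) with h' | h' <;> omega
  have hrange : ∀ A ∈ F, n ≤ rank A + 3 ∧ rank A ≤ n + 3 := by
    intro A hA
    by_contra hcon
    have hall : midFive n ∪ layer n 2 (n - 3) ∪ layer n 2 (n + 3) ⊆ F := by
      intro B hB
      by_contra hBF
      have h := hF.abs_rank_le hA hBF
      simp only [mem_union, mem_midFive, mem_layer] at hB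
      rw [abs_le'] at h
      rcases abs_cases ((rank B : ℤ) - n) with h' | h' <;> omega
    have h := card_le_card hall
    rw [card_union_of_disjoint, card_union_of_disjoint,
      card_layer_reversal (r := n - 3) (s := n + 3) (by omega)] at h
    · omega
    · refine disjoint_left.2 fun x hx hx' => ?_
      rw [mem_midFive] at hx
      rw [mem_layer] at hx'
      omega
    · refine disjoint_left.2 fun x hx hx' => ?_
      simp only [mem_union, mem_midFive, mem_layer] at hx hx'
      omega
  have hEq : F = midFive n ∪ {x ∈ F | rank x + 3 = n} ∪ {x ∈ F | rank x = n + 3} := by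
    ext x
    simp only [mem_union, mem_filter]
    constructor
    · intro hx
      have := hrange x hx
      by_cases hx5 : x ∈ midFive n
      · exact Or.inl (Or.inl hx5)
      · rw [mem_midFive] at hx5
        by_cases hx3 : rank x + 3 = n
        · exact Or.inl (Or.inr ⟨hx, hx3⟩)
        · exact Or.inr ⟨hx, by omega⟩
    · rintro ((hx | hx) | hx)
      · exact hsub hx
      · exact hx.1
      · exact hx.1
  refine ⟨_, _, fun x hx => (mem_filter.1 hx).2, fun x hx => (mem_filter.1 hx).2, hEq, ?_⟩
  conv_lhs => rw [hEq]
  rw [card_union_of_disjoint, card_union_of_disjoint]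
  · refine disjoint_left.2 fun x hx hx' => ?_
    rw [mem_midFive] at hx
    rw [mem_filter] at hx'
    omega
  · refine disjoint_left.2 fun x hx hx' => ?_
    simp only [mem_union, mem_midFive, mem_filter] at hx hx'
    omega

/-- A family of the critical size that is better than all centered ones. -/
lemma exists_comp_add_lt (hn : 2000 ≤ n) : ∃ F' : Finset (Grid n 2),
    #F' + n.choose 3 + 1 = #(midFive n) + #(layer n 2 (n + 3)) ∧
    comp F' + weight n 1 < comp (midFive n ∪ ∅ ∪ {y ∈ layer n 2 (n + 3) | zeros y ≠ 0}) := by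
  set Y : Finset (Grid n 2) := {y ∈ layer n 2 (n + 3) | zeros y ≠ 0} with hY
  obtain ⟨v, hv0, hv2⟩ := exists_rank_sub_two (n := n) (by omega)
  have hr := rank_add_zeros v
  have h1 := zeros_add_ones_add_twos v
  rw [union_empty]
  have hv : v ∈ midFive n ∪ Y := mem_union_left _ (mem_midFive.2 (by omega))
  have hdis : Disjoint ((midFive n ∪ Y).erase v) {v} :=
    disjoint_singleton_right.2 (notMem_erase _ _)
  have hEq : midFive n ∪ Y = (midFive n ∪ Y).erase v ∪ {v} := by
    rw [union_comm _ {v}, ← insert_eq, insert_erase hv]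
  have hMY : Disjoint (midFive n) Y := disjoint_left.2 fun x hx hx' => by
    have := mem_midFive.1 hx
    have := mem_layer.1 (mem_filter.1 hx').1
    omega
  refine ⟨(midFive n ∪ Y).erase v, ?_, ?_⟩
  · have h2 := card_erase_add_one hv
    rw [card_union_of_disjoint hMY] at h2
    have h3 := card_filter_add_card_filter_not (s := layer n 2 (n + 3)) (fun y => zeros y = 0)
    have h4 : #{y ∈ layer n 2 (n + 3) | zeros y = 0} = n.choose 3 := by
      rw [← card_upper_zero]
      congr 1
      ext y; simp [upper, layer]
    have h5 : #{y ∈ layer n 2 (n + 3) | ¬zeros y = 0} = #Y := rfl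
    omega
  · conv_rhs => rw [hEq]
    rw [comp_union hdis, sum_singleton, comp_eq_zero (R := {v}) (r := rank v) (by simp), add_zero,
      add_lt_add_iff_left]
    have h2 := card_filter_rank_Ioo_above v (n + 4)
    rw [show n + 4 - rank v = 6 by omega, sum_Ioo_zero_six,
      sum_congr rfl fun j _ => card_above v (j + 1), hv0, show ones v = n - 2 by omega] at h2
    -- Of the elements above v up to rank n + 3, the family misses only those of class 0.
    have h3 : #{z | v < z ∧ rank z < n + 4} ≤ deg ((midFive n ∪ Y).erase v) v + #(upper n 0) := by
      refine (card_le_card fun z hz => ?_).trans (card_union_le _ _)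
      obtain ⟨hlt, hz⟩ := (mem_filter.1 hz).2
      have := rank_strictMono hlt
      simp only [mem_union, mem_filter, mem_erase, mem_midFive, upper, mem_univ, true_and, hY,
        mem_layer]
      by_cases h4 : rank z = n + 3 ∧ zeros z = 0
      · exact Or.inr h4
      · exact Or.inl ⟨⟨hlt.ne', by omega⟩, Or.inr hlt⟩
    rw [card_upper_zero] at h3
    have := weight_one_add_lt hn
    omega

/-- Both sides are compared with the five middle layers plus the classes a ≥ 1 of layer n + 3, which
has one element too many: a centered family saves at most `weight n 1` on it, and deleting the rank
n - 2 element saves strictly more. -/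
theorem not_isOptimal_of_isCentered (hn : 10 ^ 10 ≤ n) {M : ℕ}
    (hM : M + n.choose 3 + 1 = middleSize 6 n 2) {F : Finset (Grid n 2)} (hF : IsCentered F) :
    ¬ IsOptimal M F := by
  rintro ⟨hcard, hopt⟩
  rw [middleSize_six (by omega)] at hM
  have h1 := choose_three_add_two_le_card_layer (n := n) (by omega)
  obtain ⟨X, Y, hX, hY, rfl, h2⟩ := hF.exists_eq_midFive_union (by omega) (by omega) (by omega)
  obtain ⟨F', h3, h4⟩ := exists_comp_add_lt (n := n) (by omega)
  have h5 := comp_add_le hn hX hY (by omega)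
  have h6 := hopt F' (by omega)
  omega

lemma choose_three_lt_middleSize_six (hn : 2000 ≤ n) : n.choose 3 + 1 ≤ middleSize 6 n 2 := by
  rw [middleSize_six (by omega)]
  have := choose_three_add_two_le_card_layer hn
  omega

lemma middleSize_le_card (r n k : ℕ) : middleSize r n k ≤ Fintype.card (Grid n k) := by
  rw [middleSize, ← card_univ, ← card_biUnion]
  · exact card_le_card (subset_univ _)
  · intro s _ t _ hst
    refine disjoint_left.2 fun x hx hx' => hst ?_
    rw [← (mem_filter.1 hx).2, ← (mem_filter.1 hx').2]

end CenteredFamilies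

theorem mainTheorem1 :
    -- (a)
    (∀ ε : ℝ, 0 < ε → ∃ n₀ : ℕ, ∀ n : ℕ, n₀ ≤ n →
      ∀ M : ℕ, (M : ℝ) ≤ (1 - ε) * (CenteredFamilies.middleSize 3 n 2 : ℝ) →
        ∃ F : Finset (CenteredFamilies.Grid n 2),
          CenteredFamilies.IsOptimal M F ∧ CenteredFamilies.IsCentered F) ∧
    -- (b)
    (∃ n₀ : ℕ, ∀ n : ℕ, n₀ ≤ n →
      ∃ M : ℕ,
        (M : ℤ) = (CenteredFamilies.middleSize 6 n 2 : ℤ) - (n.choose 3 : ℤ) - 1 ∧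
        ∀ F : Finset (CenteredFamilies.Grid n 2),
          CenteredFamilies.IsCentered F → ¬ CenteredFamilies.IsOptimal M F) ∧
    -- the conjecture fails for `k = 2`
    (¬ ∃ n₀ : ℕ, ∀ n : ℕ, n₀ ≤ n → CenteredFamilies.HasCenterednessProperty n 2) := by
  refine ⟨CenteredFamilies.exists_isOptimal_isCentered, ⟨10 ^ 10, fun n hn => ?_⟩, ?_⟩
  · have h := CenteredFamilies.choose_three_lt_middleSize_six (n := n) (by omega)
    refine ⟨CenteredFamilies.middleSize 6 n 2 - n.choose 3 - 1, by omega, fun F hF => ?_⟩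
    exact CenteredFamilies.not_isOptimal_of_isCentered hn (by omega) hF
  · rintro ⟨n₀, hn₀⟩
    have h := CenteredFamilies.choose_three_lt_middleSize_six (n := max n₀ (10 ^ 10)) (by omega)
    have h' := CenteredFamilies.middleSize_le_card 6 (max n₀ (10 ^ 10)) 2
    obtain ⟨F, hopt, hF⟩ := hn₀ (max n₀ (10 ^ 10)) (le_max_left _ _)
      (CenteredFamilies.middleSize 6 (max n₀ (10 ^ 10)) 2 - (max n₀ (10 ^ 10)).choose 3 - 1)
      (by omega)
    exact CenteredFamilies.not_isOptimal_of_isCentered (le_max_right _ _) (by omega) hF hopt
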